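/- **Conventions.** A parameterized problem consists of a set of instances, each written as a word over a finite alphabet (different instances by different words), a set of yes-instances, and a parameter $\kappa(x)\in\mathbb N$ for every instance $x$. (A language $Q\subseteq\Sigma^*\times\mathbb N$ is the case where the instances are the pairs $(x,k)$ and $\kappa(x,k)=k$.) A *polynomial parametric transformation* (PPT) from a parameterized problem $P$ to a parameterized problem $Q$ is a map $f$ from the instances of $P$ to those of $Q$ that is computable by a Turing machine in time polynomial in the input length, such that $x$ is a yes-instance of $P$ if and only if $f(x)$ is a yes-instance of $Q$, and such that, for some polynomial $p$, $\kappa_Q(f(x))\le p(\kappa_P(x))$ for every instance $x$ of $P$. For a constant $d$, $\Gamma_{1,d}$-$\mathrm{WSAT}(k\log n)$ is the following problem: given a CNF formula over $n$ variables, all of whose clauses have at most $d$ literals, and a number $k$ (with $n$, $k$ and the indices of variables written in unary), does the formula have a satisfying assignment that sets exactly $k$ variables to true? The parameter is $k\lceil\log_2 n\rceil$ (taken to be $0$ if $n=0$). The class $\mathrm{WK}[1]$ consists of all parameterized problems that have a PPT to $\Gamma_{1,d}$-$\mathrm{WSAT}(k\log n)$ for some constant $d$. A parameterized problem $Q$ is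 $\mathrm{WK}[1]$-*hard* if every problem in $\mathrm{WK}[1]$ has a PPT to $Q$. $\textsc{Induced Matching}(vc)$ is the following problem: given a finite simple graph $G$ (by its adjacency matrix) and a number $k$ (in unary), is there a set $X$ of $2k$ vertices of $G$ such that the subgraph induced by $X$ is a matching consisting of $k$ edges? The parameter is the vertex cover number $vc(G)$, the minimum number of vertices that are incident to all edges of $G$. **Theorem.** $\textsc{Induced Matching}(vc)$ is $\mathrm{WK}[1]$-hard. -/

import Mathlib

namespace ParamComplexity

/-! ## Parameterized problems and polynomial parametric transformations -/

/-- A parameterized decision problem: a set of instances, written as words over a finite alphabet,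
the subset of yes-instances, and the parameter of each instance.  A language
`Q ⊆ Σ* × ℕ` is the case where the instances are the pairs `(x, k)` and the parameter is `k`.
The parameter function is not required to be computable. -/
structure ParamProblem where
  /-- the instances -/
  Inst : Type
  /-- the alphabet in which the instances are written -/
  Alph : Type
  [alphFintype : Fintype Alph]
  /-- the word that represents an instance -/
  enc : Inst → List Alph
  enc_injective : Function.Injective enc
  /-- the yes-instances -/
  yes : Set Inst
  /-- the parameter -/
  param : Inst → ℕ

attribute [instance] ParamProblem.alphFintype

/-- `PPT P Q`: there is a polynomial parametric transformation from `P` to `Q`, that is, a many-one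
reduction computed by a Turing machine in time polynomial in the length of the input word, such
that the parameter of the output is at most a polynomial in the parameter of the input. -/
def PPT (P Q : ParamProblem) : Prop :=
  ∃ f : P.Inst → Q.Inst,
    Nonempty (Turing.TM2ComputableInPolyTime P.enc Q.enc f) ∧
    (∀ x, x ∈ P.yes ↔ f x ∈ Q.yes) ∧
    ∃ p : Polynomial ℕ, ∀ x, Q.param (f x) ≤ p.eval (P.param x)

/-- A problem is hard for a class if every problem of the class has a PPT to it. -/
def IsHardFor (C : Set ParamProblem) (Q : ParamProblem) : Prop :=
  ∀ P ∈ C, PPT P Q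

/-! ## Words -/

theorem replicate_append_cons_inj {α : Type} {x y y' : α} (hy : y ≠ x) (hy' : y' ≠ x) :
    ∀ {a b : ℕ} {l l' : List α},
      List.replicate a x ++ y :: l = List.replicate b x ++ y' :: l' → a = b ∧ y = y' ∧ l = l'
  | 0, 0, _, _, h => by simpa using h
  | 0, _ + 1, _, _, h => by
      simp only [List.replicate_zero, List.nil_append, List.replicate_succ, List.cons_append,
        List.cons.injEq] at h
      exact absurd h.1 hy
  | _ + 1, 0, _, _, h => by
      simp only [List.replicate_zero, List.nil_append, List.replicate_succ, List.cons_append,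
        List.cons.injEq] at h
      exact absurd h.1.symm hy'
  | a + 1, b + 1, _, _, h => by
      simp only [List.replicate_succ, List.cons_append, List.cons.injEq, true_and] at h
      have := replicate_append_cons_inj hy hy' h
      exact ⟨by rw [this.1], this.2⟩

/-! ## Weighted satisfiability of `d`-CNF formulas, parameterized by `k log n` -/

/-- A literal over the variables `0, …, n - 1`: `(v, true)` is the variable `v` and `(v, false)` is
its negation. -/
abbrev Literal (n : ℕ) : Type := Fin n × Bool

/-- A clause: the disjunction of its literals. -/
abbrev Clause (n : ℕ) : Type := List (Literal n)

/-- A formula in conjunctive normal form: the conjunction of its clauses. -/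
abbrev CNF (n : ℕ) : Type := List (Clause n)

/-- The assignment `a` satisfies the formula `φ`. -/
def CNF.Sat {n : ℕ} (φ : CNF n) (a : Fin n → Bool) : Prop :=
  ∀ c ∈ φ, ∃ l ∈ c, a l.1 = l.2

/-- The weight of an assignment: the number of variables that it sets to true. -/
def weight {n : ℕ} (a : Fin n → Bool) : ℕ :=
  (Finset.univ.filter fun v => a v = true).card

/-- An instance of weighted satisfiability for `d`-CNF formulas. -/
structure WSatInst (d : ℕ) where
  /-- the number of variables -/
  n : ℕ
  /-- the weight asked for -/
  k : ℕ
  /-- the formula -/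
  formula : CNF n
  /-- every clause has at most `d` literals -/
  width_le : ∀ c ∈ formula, c.length ≤ d

/-- The alphabet in which formulas are written. -/
inductive CNFSym : Type
  | one
  | pos
  | neg
  | sep
  deriving DecidableEq

instance : Fintype CNFSym where
  elems := {CNFSym.one, CNFSym.pos, CNFSym.neg, CNFSym.sep}
  complete x := by cases x <;> decide

/-- A literal is written as the index of its variable in unary, followed by its sign. -/
def encLiteral {n : ℕ} (l : Literal n) : List CNFSym :=
  List.replicate l.1 CNFSym.one ++ [if l.2 then CNFSym.pos else CNFSym.neg]

/-- A clause is written as the list of its literals, followed by a separator. -/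
def encClause {n : ℕ} (c : Clause n) : List CNFSym :=
  c.flatMap encLiteral ++ [CNFSym.sep]

/-- The number of variables and the weight, both in unary, followed by the clauses. -/
def WSatInst.enc {d : ℕ} (x : WSatInst d) : List CNFSym :=
  List.replicate x.n CNFSym.one ++ CNFSym.sep ::
    (List.replicate x.k CNFSym.one ++ CNFSym.sep :: x.formula.flatMap encClause)

theorem encClause_append_inj {n : ℕ} : ∀ {c c' : Clause n} {w w' : List CNFSym},
    encClause c ++ w = encClause c' ++ w' → c = c' ∧ w = w'
  | [], [], _, _, h => by simpa [encClause] using h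
  | [], (v, b) :: c', w, w', h => by
      have h' : List.replicate 0 CNFSym.one ++ CNFSym.sep :: w =
          List.replicate v CNFSym.one ++ (if b then CNFSym.pos else CNFSym.neg) ::
            (encClause c' ++ w') := by
        simpa [encClause, encLiteral] using h
      have := (replicate_append_cons_inj (by decide) (by cases b <;> decide) h').2.1
      cases b <;> simp at this
  | (v, b) :: c, [], w, w', h => by
      have h' : List.replicate v CNFSym.one ++ (if b then CNFSym.pos else CNFSym.neg) ::
            (encClause c ++ w) = List.replicate 0 CNFSym.one ++ CNFSym.sep :: w' := by
        simpa [encClause, encLiteral] using h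
      have := (replicate_append_cons_inj (by cases b <;> decide) (by decide) h').2.1
      cases b <;> simp at this
  | (v, b) :: c, (v', b') :: c', w, w', h => by
      have h' : List.replicate v CNFSym.one ++ (if b then CNFSym.pos else CNFSym.neg) ::
            (encClause c ++ w) =
          List.replicate v' CNFSym.one ++ (if b' then CNFSym.pos else CNFSym.neg) ::
            (encClause c' ++ w') := by
        simpa [encClause, encLiteral] using h
      obtain ⟨h1, h2, h3⟩ := replicate_append_cons_inj (by cases b <;> decide)
        (by cases b' <;> decide) h'
      obtain ⟨h4, h5⟩ := encClause_append_inj h3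
      have h6 : b = b' := by cases b <;> cases b' <;> simp_all
      exact ⟨by rw [Fin.ext h1, h6, h4], h5⟩

theorem flatMap_encClause_injective {n : ℕ} : ∀ {φ ψ : CNF n},
    φ.flatMap encClause = ψ.flatMap encClause → φ = ψ
  | [], [], _ => rfl
  | [], _ :: _, h => by simp [encClause] at h
  | _ :: _, [], h => by simp [encClause] at h
  | c :: φ, c' :: ψ, h => by
      simp only [List.flatMap_cons] at h
      obtain ⟨h1, h2⟩ := encClause_append_inj h
      rw [h1, flatMap_encClause_injective h2]

theorem WSatInst.enc_injective (d : ℕ) : Function.Injective (WSatInst.enc (d := d)) := by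
  rintro ⟨n, k, φ, hφ⟩ ⟨n', k', ψ, hψ⟩ h
  obtain ⟨h1, -, h2⟩ := replicate_append_cons_inj (by decide) (by decide) h
  obtain ⟨h3, -, h4⟩ := replicate_append_cons_inj (by decide) (by decide) h2
  dsimp only at h1 h3 h4
  subst h1 h3
  have h5 := flatMap_encClause_injective h4
  subst h5
  rfl

/-- `Γ_{1,d}-WSAT(k log n)`: given a `d`-CNF formula with `n` variables and a number `k`, is there a
satisfying assignment of weight exactly `k`?  The parameter is `k ⌈log₂ n⌉`. -/
def wsat (d : ℕ) : ParamProblem where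
  Inst := WSatInst d
  Alph := CNFSym
  enc := WSatInst.enc
  enc_injective := WSatInst.enc_injective d
  yes := {x | ∃ a : Fin x.n → Bool, x.formula.Sat a ∧ weight a = x.k}
  param x := x.k * Nat.clog 2 x.n

/-- The class `WK[1]`: all parameterized problems that have, for some constant `d`, a polynomial
parametric transformation to `Γ_{1,d}-WSAT(k log n)`. -/
def WK1 : Set ParamProblem :=
  {P | ∃ d : ℕ, PPT P (wsat d)}

/-! ## Induced Matching, parameterized by the vertex cover number -/

/-- An instance of Induced Matching: a finite graph and the size asked for. -/
structure InducedMatchingInst where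
  /-- the number of vertices -/
  n : ℕ
  /-- the graph -/
  graph : SimpleGraph (Fin n)
  /-- the number of edges of the induced matching asked for -/
  size : ℕ

/-- The alphabet in which graphs are written. -/
inductive GraphSym : Type
  | one
  | zero
  | sep
  deriving DecidableEq

instance : Fintype GraphSym where
  elems := {GraphSym.one, GraphSym.zero, GraphSym.sep}
  complete x := by cases x <;> decide

open Classical in
/-- The adjacency matrix of a graph, row by row. -/
noncomputable def encGraph {n : ℕ} (G : SimpleGraph (Fin n)) : List GraphSym :=
  (List.finRange n).flatMap fun u =>
    (List.finRange n).map fun v => if G.Adj u v then GraphSym.one else GraphSym.zero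

/-- The number of vertices and the size asked for, both in unary, followed by the adjacency
matrix. -/
noncomputable def InducedMatchingInst.enc (x : InducedMatchingInst) : List GraphSym :=
  List.replicate x.n GraphSym.one ++ GraphSym.sep ::
    (List.replicate x.size GraphSym.one ++ GraphSym.sep :: encGraph x.graph)

theorem encGraph_injective {n : ℕ} {G H : SimpleGraph (Fin n)} (h : encGraph G = encGraph H) :
    G = H := by
  classical
  have key : ∀ l : List (Fin n),
      (l.flatMap fun u => (List.finRange n).map fun v =>
        if G.Adj u v then GraphSym.one else GraphSym.zero) =
      (l.flatMap fun u => (List.finRange n).map fun v =>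
        if H.Adj u v then GraphSym.one else GraphSym.zero) →
      ∀ u ∈ l, ∀ v, G.Adj u v ↔ H.Adj u v := by
    intro l
    induction l with
    | nil => simp
    | cons w l ih =>
      intro hl u hu v
      simp only [List.flatMap_cons] at hl
      obtain ⟨h1, h2⟩ := List.append_inj hl (by simp)
      rcases List.mem_cons.1 hu with rfl | hu
      · have := List.map_inj_left.1 h1 v (List.mem_finRange v)
        by_cases hG : G.Adj u v <;> by_cases hH : H.Adj u v <;> simp_all
      · exact ih h2 u hu v
  ext u v
  refine key (List.finRange n) ?_ u (List.mem_finRange u) v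
  unfold encGraph at h
  convert h

theorem InducedMatchingInst.enc_injective : Function.Injective InducedMatchingInst.enc := by
  rintro ⟨n, G, k⟩ ⟨n', H, k'⟩ h
  obtain ⟨h1, -, h2⟩ := replicate_append_cons_inj (by decide) (by decide) h
  obtain ⟨h3, -, h4⟩ := replicate_append_cons_inj (by decide) (by decide) h2
  dsimp only at h1 h3 h4
  subst h1 h3
  have h5 := encGraph_injective h4
  subst h5
  rfl

/-- `G` has a set `X` of `2k` vertices that induces a matching.  Such a matching has exactly `k`
edges, because each vertex of `X` is on exactly one of them. -/
def HasInducedMatching {V : Type} (G : SimpleGraph V) (k : ℕ) : Prop :=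
  ∃ X : Finset V, X.card = 2 * k ∧ ((⊤ : G.Subgraph).induce (X : Set V)).IsMatching

/-- `Induced Matching(vc)`: given a graph `G` and a number `k`, does `G` have an induced matching of
size `k`?  The parameter is the vertex cover number of `G`. -/
noncomputable def inducedMatchingVC : ParamProblem where
  Inst := InducedMatchingInst
  Alph := GraphSym
  enc := InducedMatchingInst.enc
  enc_injective := InducedMatchingInst.enc_injective
  yes := {x | HasInducedMatching x.graph x.size}
  param x := x.graph.vertexCoverNum.toNat

end ParamComplexity

/-! Membership in `WK1` means having a transformation to some `wsat d`, and transformations compose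
(`PPT.trans`). So it is enough to reduce each `wsat d` to Induced Matching, with a vertex cover
number polynomial in `k * clog 2 n`.

An assignment of weight `k` is a sequence `0 = y 0 < y 1 < ⋯ < y k < y (k + 1) = n + 1`, the true
variables being shifted by one; its inner elements are described by about `k log n` bits. The
falsity of a literal is visible in a single gap `y g, y (g + 1)`: a false negated variable is the
left end of a gap, and a false unnegated variable lies strictly inside one. Hence a false clause
with at most `D = d + 1` literals is visible in `D` gaps (`IsSelection.sat_iff`). The sequence
satisfies the formula exactly if, for each of the `(k + 1) ^ D` tuples of gap numbers, the ends of
those gaps show no clause to be false.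

The graph has a star for each such tuple (a block). Its leaves are the `D`-tuples of pairs of ends,
at most `(n + 2) ^ (2 * D)` of them, that show no false clause. For each bit there is a triangle on
the values 0 and 1 and a spare vertex, and a leaf is joined to the bit values that contradict it. If
the matching has as many edges as there are stars and triangles together, counting forces one edge
at each center and one inside each triangle (`exists_assignment_of_hasInducedMatching_selGraph`).
The triangles then choose bit values, the stars choose leaves that agree with them, and agreement
glues the leaves into one sequence (`exists_isSelection_of_assignment`). The leaves are many but
independent: centers and triangles form a vertex cover whose size is polynomial in the parameter.

Computability in polynomial time is proved for actual stack machines. Functions built from bounded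
sums, tests and input lookups are computed by programs of a small register language, and these
programs compile to machines (`Run.iterate_code`). Machines are composed by letting the second one
start on the output stack of the first. -/

/-! ## Composition of polynomial-time stack machines -/

namespace Turing.TM2

open StateTransition

/-! ### Step-by-step simulation of a machine inside a larger one. -/

section Embedding

variable {K K' : Type} {Γ : K → Type} {Γ' : K' → Type} {Λ Λ' σ σ' : Type}

/-- Runs a statement on the stacks `κ k` of a larger machine, with labels translated by `lb` and
internal states by `ι` and `π`; instead of halting, the statement continues with `fin`. -/
def Stmt.embed (κ : K → K') (e : ∀ k, Γ k ≃ Γ' (κ k)) (lb : Λ → Λ') (ι : σ → σ') (π : σ' → σ)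
    (fin : Stmt Γ' Λ' σ') : Stmt Γ Λ σ → Stmt Γ' Λ' σ'
  | .push k f q => .push (κ k) (fun s => e k (f (π s))) (embed κ e lb ι π fin q)
  | .peek k f q =>
      .peek (κ k) (fun s o => ι (f (π s) (o.map (e k).symm))) (embed κ e lb ι π fin q)
  | .pop k f q =>
      .pop (κ k) (fun s o => ι (f (π s) (o.map (e k).symm))) (embed κ e lb ι π fin q)
  | .load f q => .load (fun s => ι (f (π s))) (embed κ e lb ι π fin q)
  | .branch f q₁ q₂ =>
      .branch (fun s => f (π s)) (embed κ e lb ι π fin q₁) (embed κ e lb ι π fin q₂)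
  | .goto f => .goto fun s => lb (f (π s))
  | .halt => fin

/-- The stacks `S'` hold the stacks `S` at the positions `κ k`, and are empty elsewhere. -/
def StacksEmbed (κ : K → K') (e : ∀ k, Γ k ≃ Γ' (κ k)) (S : ∀ k, List (Γ k))
    (S' : ∀ k, List (Γ' k)) : Prop :=
  (∀ k, S' (κ k) = (S k).map (e k)) ∧ ∀ k', k' ∉ Set.range κ → S' k' = []

theorem StacksEmbed.update [DecidableEq K] [DecidableEq K'] {κ : K → K'}
    (hκ : Function.Injective κ) {e : ∀ k, Γ k ≃ Γ' (κ k)} {S : ∀ k, List (Γ k)}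
    {S' : ∀ k, List (Γ' k)} (h : StacksEmbed κ e S S') (k : K) (l : List (Γ k)) :
    StacksEmbed κ e (Function.update S k l) (Function.update S' (κ k) (l.map (e k))) := by
  refine ⟨fun i => ?_, fun k' hk' => ?_⟩
  · by_cases hi : i = k
    · subst hi; simp
    · rw [Function.update_of_ne (hκ.ne hi), Function.update_of_ne hi, h.1]
  · rw [Function.update_of_ne, h.2 k' hk']
    rintro rfl
    exact hk' ⟨k, rfl⟩

/-- A configuration of a machine inside a larger machine that goes to `lf` when the small machine
halts. -/
def CfgEmbed (κ : K → K') (e : ∀ k, Γ k ≃ Γ' (κ k)) (lb : Λ → Λ') (lf : Option Λ') (ι : σ → σ')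
    (c : Cfg Γ Λ σ) (c' : Cfg Γ' Λ' σ') : Prop :=
  c'.l = c.l.elim lf (fun l => some (lb l)) ∧ c'.var = ι c.var ∧ StacksEmbed κ e c.stk c'.stk

/-- Every operation commutes with the renaming of stacks, labels and states, by induction on the
statement. Only halting differs: there `hfin` makes the larger machine go to `lf` with state and
stacks untouched. -/
theorem CfgEmbed.stepAux [DecidableEq K] [DecidableEq K'] {κ : K → K'}
    (hκ : Function.Injective κ) {e : ∀ k, Γ k ≃ Γ' (κ k)} {lb : Λ → Λ'} {lf : Option Λ'}
    {ι : σ → σ'} {π : σ' → σ} (hπ : ∀ s, π (ι s) = s) {fin : Stmt Γ' Λ' σ'}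
    (hfin : ∀ v S, TM2.stepAux fin v S = ⟨lf, v, S⟩) (q : Stmt Γ Λ σ) :
    ∀ (v : σ) (S : ∀ k, List (Γ k)) (S' : ∀ k, List (Γ' k)), StacksEmbed κ e S S' →
      CfgEmbed κ e lb lf ι (TM2.stepAux q v S)
        (TM2.stepAux (Stmt.embed κ e lb ι π fin q) (ι v) S') := by
  induction q with
  | push k f q ih =>
    intro v S S' h
    have := h.update hκ k (f v :: S k)
    simpa [Stmt.embed, hπ, h.1] using ih v _ _ (by simpa using this)
  | peek k f q ih =>
    intro v S S' h
    simpa [Stmt.embed, hπ, h.1, Function.comp_def] using ih _ S S' h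
  | pop k f q ih =>
    intro v S S' h
    have := h.update hκ k (S k).tail
    simpa [Stmt.embed, hπ, h.1, Function.comp_def] using ih _ _ _ this
  | load f q ih =>
    intro v S S' h
    simpa [Stmt.embed, hπ] using ih _ S S' h
  | branch f q₁ q₂ ih₁ ih₂ =>
    intro v S S' h
    simp only [Stmt.embed, TM2.stepAux, hπ]
    cases f v
    · exact ih₂ v S S' h
    · exact ih₁ v S S' h
  | goto f =>
    intro v S S' h
    exact ⟨by simp [Stmt.embed, hπ], rfl, h⟩
  | halt =>
    intro v S S' h
    rw [Stmt.embed, hfin]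
    exact ⟨rfl, rfl, h⟩

theorem CfgEmbed.iterate [DecidableEq K] [DecidableEq K'] {κ : K → K'}
    (hκ : Function.Injective κ) {e : ∀ k, Γ k ≃ Γ' (κ k)} {lb : Λ → Λ'} {lf : Option Λ'}
    {ι : σ → σ'} {π : σ' → σ} (hπ : ∀ s, π (ι s) = s) {fin : Stmt Γ' Λ' σ'}
    (hfin : ∀ v S, TM2.stepAux fin v S = ⟨lf, v, S⟩) {M : Λ → Stmt Γ Λ σ}
    {M' : Λ' → Stmt Γ' Λ' σ'} (hM : ∀ l, M' (lb l) = Stmt.embed κ e lb ι π fin (M l)) :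
    ∀ (n : ℕ) (c d : Cfg Γ Λ σ) (c' : Cfg Γ' Λ' σ'), CfgEmbed κ e lb lf ι c c' →
      (flip bind (step M))^[n] (some c) = some d →
      ∃ d', (flip bind (step M'))^[n] (some c') = some d' ∧ CfgEmbed κ e lb lf ι d d'
  | 0, c, d, c', h, hd => by
      obtain rfl : c = d := by simpa using hd
      exact ⟨c', rfl, h⟩
  -- A halted configuration has no successor, so it cannot reach `some d` in a positive number of
  -- steps. The larger machine is therefore never compared after the smaller one has halted.
  | n + 1, ⟨none, v, S⟩, d, c', h, hd => by
      exfalso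
      have h0 : ∀ m, (flip bind (step M))^[m] none = none := by
        intro m
        induction m with
        | zero => rfl
        | succ m ih => rw [Function.iterate_succ_apply]; exact ih
      rw [Function.iterate_succ_apply] at hd
      have h1 : (flip bind (step M)) (some ⟨none, v, S⟩) = none := rfl
      rw [h1, h0] at hd
      cases hd
  | n + 1, ⟨some l, v, S⟩, d, ⟨l', v', S'⟩, h, hd => by
      obtain ⟨h1, h2, h3⟩ := h
      dsimp only [Option.elim] at h1 h2 h3
      subst h1 h2
      rw [Function.iterate_succ_apply] at hd ⊢
      have h4 := CfgEmbed.stepAux hκ hπ hfin (lb := lb) (M l) v S S' h3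
      rw [← hM] at h4
      exact CfgEmbed.iterate hκ hπ hfin hM n _ d _ h4 hd

end Embedding

/-! ### Stack heights are bounded by the running time. -/

section Growth

variable {K : Type} {Γ : K → Type} {Λ σ : Type}

/-- A bound on the number of symbols that a statement pushes. -/
def Stmt.pushes : Stmt Γ Λ σ → ℕ
  | .push _ _ q => q.pushes + 1
  | .peek _ _ q => q.pushes
  | .pop _ _ q => q.pushes
  | .load _ q => q.pushes
  | .branch _ q₁ q₂ => max q₁.pushes q₂.pushes
  | .goto _ => 0
  | .halt => 0

theorem length_stepAux_le [DecidableEq K] (q : Stmt Γ Λ σ) (k : K) :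
    ∀ (v : σ) (S : ∀ k, List (Γ k)), ((stepAux q v S).stk k).length ≤ (S k).length + q.pushes := by
  induction q with
  | push i f q ih =>
    intro v S
    refine (ih _ _).trans ?_
    by_cases h : k = i
    · subst h; simp [Stmt.pushes]; omega
    · simp [Function.update_of_ne h, Stmt.pushes]
  | peek i f q ih => intro v S; exact ih _ _
  | pop i f q ih =>
    intro v S
    refine (ih _ _).trans ?_
    by_cases h : k = i
    · subst h; simp [Stmt.pushes]
    · simp [Function.update_of_ne h, Stmt.pushes]
  | load f q ih => intro v S; exact ih _ _
  | branch f q₁ q₂ ih₁ ih₂ =>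
    intro v S
    simp only [stepAux, Stmt.pushes]
    cases f v
    · exact (ih₂ v S).trans (by simp)
    · exact (ih₁ v S).trans (by simp)
  | goto f => intro v S; simp [Stmt.pushes]
  | halt => intro v S; simp [Stmt.pushes]

theorem length_iterate_le [DecidableEq K] (M : Λ → Stmt Γ Λ σ) {C : ℕ}
    (hC : ∀ l, (M l).pushes ≤ C) (k : K) :
    ∀ (n : ℕ) (c d : Cfg Γ Λ σ), (flip bind (step M))^[n] (some c) = some d →
      (d.stk k).length ≤ (c.stk k).length + n * C
  | 0, c, d, h => by
      obtain rfl : c = d := by simpa using h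
      simp
  | n + 1, c, d, h => by
      rw [Function.iterate_succ_apply'] at h
      cases hm : (flip bind (step M))^[n] (some c) with
      | none => rw [hm] at h; cases h
      | some m =>
        rw [hm] at h
        have ih := length_iterate_le M hC k n c m hm
        obtain ⟨l, v, S⟩ := m
        cases l with
        | none => cases h
        | some l =>
          obtain rfl : stepAux (M l) v S = d := by
            have : some (stepAux (M l) v S) = some d := h
            simpa using this
          have h1 := length_stepAux_le (M l) k v S
          have h2 := hC l
          rw [Nat.succ_mul]
          dsimp only at ih
          omega

end Growth

end Turing.TM2

theorem Polynomial.eval_mono_nat (p : Polynomial ℕ) {a b : ℕ} (h : a ≤ b) :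
    p.eval a ≤ p.eval b := by
  rw [Polynomial.eval_eq_sum, Polynomial.eval_eq_sum]
  exact Finset.sum_le_sum fun i _ => Nat.mul_le_mul_left _ (Nat.pow_le_pow_left h i)

namespace Turing

open StateTransition

theorem initList_stk_self (tm : FinTM2) (s : List (tm.Γ tm.k₀)) :
    (initList tm s).stk tm.k₀ = s := by
  simp [initList]

theorem initList_stk_of_ne (tm : FinTM2) (s : List (tm.Γ tm.k₀)) {k : tm.K} (h : k ≠ tm.k₀) :
    (initList tm s).stk k = [] := by
  simp [initList, h]

theorem haltList_stk_self (tm : FinTM2) (s : List (tm.Γ tm.k₁)) :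
    (haltList tm s).stk tm.k₁ = s := by
  simp [haltList]

theorem haltList_stk_of_ne (tm : FinTM2) (s : List (tm.Γ tm.k₁)) {k : tm.K} (h : k ≠ tm.k₁) :
    (haltList tm s).stk k = [] := by
  simp [haltList, h]

/-- The number of symbols in the output of a machine is at most the length of the input plus a
constant times the number of steps. -/
theorem TM2OutputsInTime.exists_length_le (tm : FinTM2) :
    ∃ C : ℕ, ∀ (l : List (tm.Γ tm.k₀)) (l' : List (tm.Γ tm.k₁)) (t : ℕ),
      TM2OutputsInTime tm l (some l') t → l'.length ≤ l.length + t * C := by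
  have := tm.ΛFin
  refine ⟨Finset.univ.sup fun l => (tm.m l).pushes, fun l l' t h => ?_⟩
  have h1 := TM2.length_iterate_le tm.m
    (fun l => Finset.le_sup (f := fun l => (tm.m l).pushes) (Finset.mem_univ l)) tm.k₁ h.steps
    (initList tm l) (haltList tm l') h.evals_in_steps
  rw [haltList_stk_self] at h1
  have h2 : ((initList tm l).stk tm.k₁).length ≤ l.length := by
    by_cases hk : tm.k₁ = tm.k₀
    · have : ∀ k, k = tm.k₀ → ((initList tm l).stk k).length ≤ l.length := by
        rintro k rfl
        rw [initList_stk_self]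
      exact this _ hk
    · simp [initList_stk_of_ne tm l hk]
  have h3 := Nat.mul_le_mul_right (Finset.univ.sup fun l => (tm.m l).pushes) h.steps_le_m
  omega

/-! ### Two machines that share one stack. -/

section Composition

variable (tm₁ tm₂ : FinTM2) (e : tm₂.Γ tm₂.k₀ ≃ tm₁.Γ tm₁.k₁)

/-- The stacks of the composed machine: those of the first machine and those of the second, except
that the input stack of the second is the output stack of the first. -/
abbrev CompStack : Type := tm₁.K ⊕ {k : tm₂.K // k ≠ tm₂.k₀}

/-- The stack alphabets of the composed machine. -/
def CompΓ : CompStack tm₁ tm₂ → Type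
  | .inl k => tm₁.Γ k
  | .inr k => tm₂.Γ k

/-- The position of the stacks of the second machine. -/
def compStackSnd (k : tm₂.K) : CompStack tm₁ tm₂ :=
  if h : k = tm₂.k₀ then .inl tm₁.k₁ else .inr ⟨k, h⟩

theorem compStackSnd_injective : Function.Injective (compStackSnd tm₁ tm₂) := by
  intro k k' h
  unfold compStackSnd at h
  split_ifs at h with h1 h2 h2
  · rw [h1, h2]
  · simpa using h

variable {tm₁ tm₂}

/-- The identification of the alphabets of the second machine. -/
def compEquivSnd (k : tm₂.K) : tm₂.Γ k ≃ CompΓ tm₁ tm₂ (compStackSnd tm₁ tm₂ k) :=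
  if h : k = tm₂.k₀ then
    (Equiv.cast (by rw [h])).trans (e.trans (Equiv.cast (by simp [compStackSnd, h, CompΓ])))
  else Equiv.cast (by simp [compStackSnd, h, CompΓ])

/-- The composition of two machines. -/
def compTM : FinTM2 :=
  haveI := tm₁.kFin
  haveI := tm₂.kFin
  haveI := tm₁.ΛFin
  haveI := tm₂.ΛFin
  haveI := tm₁.σFin
  haveI := tm₂.σFin
  { K := CompStack tm₁ tm₂
    kFin := inferInstance
    k₀ := .inl tm₁.k₀
    k₁ := compStackSnd tm₁ tm₂ tm₂.k₁
    Γ := CompΓ tm₁ tm₂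
    Λ := tm₁.Λ ⊕ tm₂.Λ
    main := .inl tm₁.main
    ΛFin := inferInstance
    σ := tm₁.σ × tm₂.σ
    initialState := (tm₁.initialState, tm₂.initialState)
    σFin := inferInstance
    Γk₀Fin := tm₁.Γk₀Fin
    m := fun
      | .inl l => TM2.Stmt.embed (Γ' := CompΓ tm₁ tm₂) Sum.inl (fun _ => Equiv.refl _) Sum.inl
          (fun s => (s, tm₂.initialState)) Prod.fst (.goto fun _ => .inr tm₂.main) (tm₁.m l)
      | .inr l => TM2.Stmt.embed (compStackSnd tm₁ tm₂) (compEquivSnd e) Sum.inr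
          (fun s => (tm₁.initialState, s)) Prod.snd .halt (tm₂.m l) }

/-- When the first machine halts, its internal state is the initial one and only its output stack
may be nonempty. This stack is the input stack of the second machine, so the configuration, now at
the label `tm₂.main`, embeds an initial configuration of the second machine and the two simulations
can be chained. -/
theorem compTM_outputs {l : List (tm₁.Γ tm₁.k₀)} {l' : List (tm₂.Γ tm₂.k₀)}
    {l'' : List (tm₂.Γ tm₂.k₁)} {t₁ t₂ : ℕ} (h₁ : TM2OutputsInTime tm₁ l (some (l'.map e)) t₁)
    (h₂ : TM2OutputsInTime tm₂ l' (some l'') t₂) :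
    Nonempty (TM2OutputsInTime (compTM e) l (some (l''.map (compEquivSnd e tm₂.k₁)))
      (t₁ + t₂)) := by
  have hc₀ : TM2.CfgEmbed (Sum.inl : tm₁.K → CompStack tm₁ tm₂) (Γ' := CompΓ tm₁ tm₂)
      (fun _ => Equiv.refl _) (Sum.inl : tm₁.Λ → tm₁.Λ ⊕ tm₂.Λ) (some (Sum.inr tm₂.main))
      (fun s => (s, tm₂.initialState)) (initList tm₁ l) (initList (compTM e) l) := by
    refine ⟨rfl, rfl, fun k => ?_, fun k hk => ?_⟩
    · by_cases hk : k = tm₁.k₀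
      · subst hk
        rw [initList_stk_self]
        exact (initList_stk_self (compTM e) l).trans (List.map_id _).symm
      · rw [initList_stk_of_ne _ _ hk]
        exact initList_stk_of_ne (compTM e) l (k := Sum.inl k)
          (fun h => hk (Sum.inl_injective h))
    · exact initList_stk_of_ne (compTM e) l (k := k) (fun h => hk ⟨_, h.symm⟩)
  obtain ⟨c, hc, hc1, hc2, hc3⟩ := TM2.CfgEmbed.iterate Sum.inl_injective (π := Prod.fst)
    (fun _ => rfl) (fin := .goto fun _ => .inr tm₂.main) (fun _ _ => rfl) (M := tm₁.m)
    (M' := (compTM e).m) (fun _ => rfl) h₁.steps _ (haltList tm₁ (l'.map e)) _ hc₀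
    h₁.evals_in_steps
  have hd₀ : TM2.CfgEmbed (compStackSnd tm₁ tm₂) (compEquivSnd e)
      (Sum.inr : tm₂.Λ → tm₁.Λ ⊕ tm₂.Λ) none (fun s => (tm₁.initialState, s))
      (initList tm₂ l') c := by
    refine ⟨hc1, hc2, fun k => ?_, fun k hk => ?_⟩
    · by_cases hk : k = tm₂.k₀
      · subst hk
        rw [initList_stk_self]
        have h4 := hc3.1 tm₁.k₁
        rw [haltList_stk_self] at h4
        -- The alphabet of the shared stack is known only up to a cast along an equality of
        -- positions. With the position as a variable `k'`, that equality can be eliminated and the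
        -- cast disappears.
        have key : ∀ (k' : CompStack tm₁ tm₂) (hk' : Sum.inl tm₁.k₁ = k')
            (E : tm₂.Γ tm₂.k₀ ≃ CompΓ tm₁ tm₂ k')
            (_ : ∀ x, E x = Equiv.cast (by subst hk'; rfl) (e x)), c.stk k' = l'.map E := by
          rintro k' rfl E hE
          rw [h4, List.map_map]
          exact List.map_congr_left fun x _ => (hE x).symm
        refine key _ (by simp [compStackSnd]) _ fun x => ?_
        simp only [compEquivSnd, dif_pos]
        rfl
      · rw [initList_stk_of_ne _ _ hk]
        refine hc3.2 _ ?_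
        rintro ⟨k', hk'⟩
        simp [compStackSnd, hk] at hk'
    · cases k with
      | inl k =>
        rw [hc3.1 k, haltList_stk_of_ne]
        · rfl
        · rintro rfl
          exact hk ⟨tm₂.k₀, by simp [compStackSnd]⟩
      | inr k =>
        refine absurd ⟨k.1, ?_⟩ hk
        simp [compStackSnd, k.2]
  obtain ⟨d, hd, hd1, hd2, hd3⟩ := TM2.CfgEmbed.iterate (compStackSnd_injective tm₁ tm₂)
    (π := Prod.snd) (fun _ => rfl) (fin := .halt) (fun _ _ => rfl) (M := tm₂.m)
    (M' := (compTM e).m) (fun _ => rfl) h₂.steps _ (haltList tm₂ l'') _ hd₀ h₂.evals_in_steps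
  have hd' : d = haltList (compTM e) (l''.map (compEquivSnd e tm₂.k₁)) := by
    obtain ⟨dl, dv, dS⟩ := d
    dsimp only [haltList, Option.elim] at hd1 hd2
    subst hd1 hd2
    refine congrArg (TM2.Cfg.mk none _) (funext fun k => ?_)
    by_cases hk : k ∈ Set.range (compStackSnd tm₁ tm₂)
    · obtain ⟨k, rfl⟩ := hk
      refine (hd3.1 k).trans ?_
      by_cases hk : k = tm₂.k₁
      · subst hk
        rw [haltList_stk_self]
        exact (haltList_stk_self (compTM e) _).symm
      · rw [haltList_stk_of_ne _ _ hk]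
        exact (haltList_stk_of_ne (compTM e) _ (k := compStackSnd tm₁ tm₂ k)
          (fun h => hk (compStackSnd_injective tm₁ tm₂ h))).symm
    · refine (hd3.2 k hk).trans ?_
      exact (haltList_stk_of_ne (compTM e) _ (k := k) (fun h => hk ⟨_, h.symm⟩)).symm
  subst hd'
  refine ⟨⟨⟨h₂.steps + h₁.steps, ?_⟩, ?_⟩⟩
  · rw [Function.iterate_add_apply]
    exact (congrArg _ hc).trans hd
  · have := h₁.steps_le_m
    have := h₂.steps_le_m
    dsimp only
    omega

end Composition

/-- Polynomial-time computable functions are closed under composition. -/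
theorem TM2ComputableInPolyTime.nonempty_comp {α β γ αΓ βΓ γΓ : Type} {eα : α → List αΓ}
    {eβ : β → List βΓ} {eγ : γ → List γΓ} {f : α → β} {g : β → γ}
    (h₁ : TM2ComputableInPolyTime eα eβ f) (h₂ : TM2ComputableInPolyTime eβ eγ g) :
    Nonempty (TM2ComputableInPolyTime eα eγ (g ∘ f)) := by
  classical
  let e := h₂.inputAlphabet.trans h₁.outputAlphabet.symm
  obtain ⟨C, hC⟩ := TM2OutputsInTime.exists_length_le h₁.tm
  have key : ∀ a, Nonempty (TM2OutputsInTime (compTM e)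
      (List.map h₁.inputAlphabet.invFun (eα a))
      (some (((eγ (g (f a))).map h₂.outputAlphabet.invFun).map (compEquivSnd e h₂.tm.k₁)))
      (h₁.time.eval (eα a).length + h₂.time.eval (eβ (f a)).length)) := by
    intro a
    refine compTM_outputs e (l' := (eβ (f a)).map h₂.inputAlphabet.invFun) ?_ (h₂.outputsFun (f a))
    have := h₁.outputsFun a
    rw [List.map_map]
    have he : e ∘ h₂.inputAlphabet.invFun = h₁.outputAlphabet.invFun := by
      funext x
      simp [e]
    rwa [he]
  refine ⟨{ tm := compTM e, inputAlphabet := h₁.inputAlphabet,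
            outputAlphabet := (compEquivSnd e h₂.tm.k₁).symm.trans h₂.outputAlphabet,
            -- The intermediate word has at most the input length plus `C` times the running time of
            -- the first machine many symbols; this is the argument of the second time bound.
            time := h₁.time + h₂.time.comp (Polynomial.X + h₁.time * Polynomial.C C),
            outputsFun := fun a => ?_ }⟩
  have h := (key a).some
  erw [List.map_map] at h
  refine ⟨h.toEvalsTo, h.steps_le_m.trans ?_⟩
  rw [Polynomial.eval_add, Polynomial.eval_comp]
  refine Nat.add_le_add_left (Polynomial.eval_mono_nat _ ?_) _
  have := hC _ _ _ (h₁.outputsFun a)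
  simpa using this

end Turing

/-! ## A register language compiled to stack machines -/

namespace RegisterProgram

/-- Programs with registers that hold natural numbers, an input tape with a head (the symbols before
the head are kept on `bak` and those after it on `inp`) and an output stack. -/
inductive Cmd (A B : Type) : Type
  | skip : Cmd A B
  | seq : Cmd A B → Cmd A B → Cmd A B
  | inc : ℕ → Cmd A B
  | dec : ℕ → Cmd A B
  /-- while the register is positive, decrease it and run the body -/
  | loop : ℕ → Cmd A B → Cmd A B
  /-- move the head one symbol forward -/
  | advance : Cmd A B
  /-- increase the register if the symbol after the head is the given one -/
  | read : A → ℕ → Cmd A B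
  /-- move the head to the beginning -/
  | rewind : Cmd A B
  /-- move the head to the end and add the number of moves to the register -/
  | forward : ℕ → Cmd A B
  /-- erase the symbols after the head -/
  | clear : Cmd A B
  /-- push a symbol on the output stack -/
  | emit : B → Cmd A B

/-- The memory of a program. -/
structure Store (A B : Type) where
  /-- the registers -/
  regs : ℕ → ℕ
  /-- the input symbols after the head -/
  inp : List A
  /-- the input symbols before the head, the last one first -/
  bak : List A
  /-- the output -/
  out : List B

/-- Sets the value of a register. -/
def Store.set {A B : Type} (s : Store A B) (r v : ℕ) : Store A B :=
  { s with regs := Function.update s.regs r v }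

theorem Store.set_self {A B : Type} (s : Store A B) (r : ℕ) : s.set r (s.regs r) = s := by
  simp [Store.set]

section

variable {A B : Type} [DecidableEq A]

/-- `Run c s t s'`: the program `c` turns the store `s` into `s'` in time `t`. -/
inductive Run : Cmd A B → Store A B → ℕ → Store A B → Prop
  | skip (s) : Run .skip s 1 s
  | seq {c c' s s' s'' t t'} : Run c s t s' → Run c' s' t' s'' → Run (.seq c c') s (t + t') s''
  | inc (r s) : Run (.inc r) s 1 (s.set r (s.regs r + 1))
  | dec (r s) : Run (.dec r) s 1 (s.set r (s.regs r - 1))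
  | loop_zero {r c s} : s.regs r = 0 → Run (.loop r c) s 1 s
  | loop_succ {r c s s' s'' n t t'} : s.regs r = n + 1 → Run c (s.set r n) t s' →
      Run (.loop r c) s' t' s'' → Run (.loop r c) s (1 + t + t') s''
  | advance (s) : Run .advance s 1 { s with inp := s.inp.tail, bak := s.inp.head?.toList ++ s.bak }
  | read (a r s) : Run (.read a r) s 1
      (s.set r (s.regs r + if s.inp.head? = some a then 1 else 0))
  | rewind (s) : Run .rewind s (s.bak.length + 1) { s with inp := s.bak.reverse ++ s.inp, bak := [] }
  | forward (r s) : Run (.forward r) s (s.inp.length + 1)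
      { s with regs := Function.update s.regs r (s.regs r + s.inp.length),
               inp := [], bak := s.inp.reverse ++ s.bak }
  | clear (s) : Run .clear s (s.inp.length + 1) { s with inp := [] }
  | emit (b s) : Run (.emit b) s 1 { s with out := b :: s.out }

end

/-! ### Compilation with exact running times. -/

section Compile

variable {A B : Type}

/-- The largest register that a program uses. -/
def Cmd.maxReg : Cmd A B → ℕ
  | .seq c c' => max c.maxReg c'.maxReg
  | .inc r => r
  | .dec r => r
  | .loop r c => max r c.maxReg
  | .read _ r => r
  | .forward r => r
  | _ => 0

/-- The stacks of the machine for a program with registers `0, …, m`. -/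
inductive Stk (m : ℕ) : Type
  | inp
  | bak
  | out
  | reg (r : Fin (m + 1))
  deriving DecidableEq, Fintype

/-- The stack of a register. -/
abbrev Stk.ofNat {m : ℕ} (r : ℕ) : Stk m := .reg (Fin.ofNat (m + 1) r)

variable (A B) in
/-- The stack alphabets. -/
abbrev StkΓ (m : ℕ) : Stk m → Type
  | .out => B
  | _ => A

/-- The labels of the machine code of a program. -/
def Cmd.Lbl : Cmd A B → Type
  | .seq c c' => c.Lbl ⊕ c'.Lbl
  | .loop _ c => Option c.Lbl
  | _ => Unit

/-- The label at which the machine code of a program is entered. -/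
def Cmd.entry : (c : Cmd A B) → c.Lbl
  | .seq c _ => .inl c.entry
  | .loop _ _ => none
  | .skip | .inc _ | .dec _ | .advance | .read _ _ | .rewind | .forward _ | .clear | .emit _ => ()

theorem Cmd.nonempty_fintype_lbl : (c : Cmd A B) → Nonempty (Fintype c.Lbl)
  | .seq c c' => by
      obtain ⟨_⟩ := c.nonempty_fintype_lbl
      obtain ⟨_⟩ := c'.nonempty_fintype_lbl
      exact ⟨inferInstanceAs (Fintype (c.Lbl ⊕ c'.Lbl))⟩
  | .loop _ c => by
      obtain ⟨_⟩ := c.nonempty_fintype_lbl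
      exact ⟨inferInstanceAs (Fintype (Option c.Lbl))⟩
  | .skip | .inc _ | .dec _ | .advance | .read _ _ | .rewind | .forward _ | .clear | .emit _ =>
      ⟨inferInstanceAs (Fintype Unit)⟩

variable [Inhabited A]

/-- The stacks that represent a store. -/
def Store.stk (m : ℕ) (s : Store A B) : (k : Stk m) → List (StkΓ A B m k)
  | .inp => s.inp
  | .bak => s.bak
  | .out => s.out
  | .reg r => List.replicate (s.regs r) default

section

variable {m : ℕ} (s : Store A B)

theorem Store.stk_ofNat {r : ℕ} (hr : r ≤ m) :
    s.stk m (.ofNat r) = List.replicate (s.regs r) default := by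
  simp [Store.stk, Nat.mod_eq_of_lt (Nat.lt_succ_of_le hr)]

theorem Store.update_reg {r : ℕ} (hr : r ≤ m) (v : ℕ) :
    Function.update (s.stk m) (.ofNat r) (List.replicate v default) = (s.set r v).stk m := by
  funext k
  cases k with
  | reg i =>
    by_cases h : (i : ℕ) = r
    · obtain rfl : i = Fin.ofNat (m + 1) r := by
        ext
        simp [h, Nat.mod_eq_of_lt (Nat.lt_succ_of_le hr)]
      rw [Function.update_self]
      simp [Store.stk, Store.set, Nat.mod_eq_of_lt (Nat.lt_succ_of_le hr)]
    · rw [Function.update_of_ne]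
      · simp [Store.stk, Store.set, Function.update_of_ne h]
      · rintro ⟨⟩
        simp [Nat.mod_eq_of_lt (Nat.lt_succ_of_le hr)] at h
  | _ => rfl

theorem Store.update_inp (l : List A) :
    Function.update (s.stk m) .inp l = Store.stk m { s with inp := l } := by
  funext k
  cases k <;> simp [Store.stk, Function.update]

theorem Store.update_bak (l : List A) :
    Function.update (s.stk m) .bak l = Store.stk m { s with bak := l } := by
  funext k
  cases k <;> simp [Store.stk, Function.update]

theorem Store.update_out (l : List B) :
    Function.update (s.stk m) .out l = Store.stk m { s with out := l } := by
  funext k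
  cases k <;> simp [Store.stk, Function.update]

end

variable [DecidableEq A]

open Turing.TM2 in
/-- The machine code of a program: its labels are embedded by `emb` into those of a larger machine,
and it continues at the label `ex`. -/
def Cmd.code (m : ℕ) {Λ : Type} : (c : Cmd A B) → (c.Lbl → Λ) → Λ → c.Lbl →
    Stmt (StkΓ A B m) Λ (Option A)
  | .skip, _, ex, _ => .goto fun _ => ex
  | .seq c c', emb, ex, l =>
      match l with
      | .inl l => c.code m (fun l => emb (.inl l)) (emb (.inr c'.entry)) l
      | .inr l => c'.code m (fun l => emb (.inr l)) ex l
  | .inc r, _, ex, _ => .push (.ofNat r) (fun _ => default) (.goto fun _ => ex)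
  | .dec r, _, ex, _ => .pop (.ofNat r) (fun _ _ => none) (.goto fun _ => ex)
  | .loop r c, emb, ex, l =>
      match l with
      | none => .pop (.ofNat r) (fun _ o => o) <| .branch Option.isSome
          (.load (fun _ => none) (.goto fun _ => emb (some c.entry))) (.goto fun _ => ex)
      | some l => c.code m (fun l => emb (some l)) (emb none) l
  | .advance, _, ex, _ => .pop .inp (fun _ o => o) <| .branch Option.isSome
      (.push .bak (fun v => v.getD default) (.load (fun _ => none) (.goto fun _ => ex)))
      (.goto fun _ => ex)
  | .read a r, _, ex, _ => .peek .inp (fun _ o => o) <| .branch (fun v => v = some a)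
      (.push (.ofNat r) (fun _ => default) (.load (fun _ => none) (.goto fun _ => ex)))
      (.load (fun _ => none) (.goto fun _ => ex))
  | .rewind, emb, ex, _ => .pop .bak (fun _ o => o) <| .branch Option.isSome
      (.push .inp (fun v => v.getD default) (.load (fun _ => none) (.goto fun _ => emb ())))
      (.goto fun _ => ex)
  | .forward r, emb, ex, _ => .pop .inp (fun _ o => o) <| .branch Option.isSome
      (.push .bak (fun v => v.getD default) <| .push (.ofNat r) (fun _ => default)
        (.load (fun _ => none) (.goto fun _ => emb ())))
      (.goto fun _ => ex)
  | .clear, emb, ex, _ => .pop .inp (fun _ o => o) <| .branch Option.isSome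
      (.load (fun _ => none) (.goto fun _ => emb ())) (.goto fun _ => ex)
  | .emit b, _, ex, _ => .push .out (fun _ => b) (.goto fun _ => ex)

-- The time in `Run` is the exact number of machine steps, so induction on the run concatenates
-- iterates. The internal state serves only as a one-symbol buffer; it is `none` on entry and exit
-- of every command.
open Turing Turing.TM2 in
theorem Run.iterate_code {c : Cmd A B} {s s' : Store A B} {t : ℕ} (h : Run c s t s') {m : ℕ} :
    ∀ {Λ : Type} {emb : c.Lbl → Λ} {ex : Λ} {M : Λ → Stmt (StkΓ A B m) Λ (Option A)},
      c.maxReg ≤ m → (∀ l, M (emb l) = c.code m emb ex l) →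
      (flip bind (step M))^[t] (some ⟨some (emb c.entry), none, s.stk m⟩) =
        some ⟨some ex, none, s'.stk m⟩ := by
  have one : ∀ {Λ : Type} {M : Λ → Stmt (StkΓ A B m) Λ (Option A)} (l : Λ) (v : Option A) (S),
      (flip bind (step M)) (some ⟨some l, v, S⟩) = some (stepAux (M l) v S) := fun _ _ _ => rfl
  induction h with
  | skip s =>
    intro Λ emb ex M hm hM
    rw [Function.iterate_one, one, hM]
    rfl
  | @seq c c' s s' s'' t t' h h' ih ih' =>
    intro Λ emb ex M hm hM
    rw [add_comm, Function.iterate_add_apply]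
    have h1 := ih (emb := fun l => emb (.inl l)) (ex := emb (.inr c'.entry)) (M := M)
      ((le_max_left _ _).trans hm) (fun l => hM (.inl l))
    have h2 := ih' (emb := fun l => emb (.inr l)) (ex := ex) (M := M)
      ((le_max_right _ _).trans hm) (fun l => hM (.inr l))
    exact (congrArg _ h1).trans h2
  | inc r s =>
    intro Λ emb ex M hm hM
    change r ≤ m at hm
    rw [Function.iterate_one, one, hM]
    simp only [Cmd.code, stepAux]
    rw [s.stk_ofNat hm, ← List.replicate_succ, s.update_reg hm]
  | dec r s =>
    intro Λ emb ex M hm hM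
    change r ≤ m at hm
    rw [Function.iterate_one, one, hM]
    simp only [Cmd.code, stepAux]
    rw [s.stk_ofNat hm, List.tail_replicate, s.update_reg hm]
  | @loop_zero r c s h =>
    intro Λ emb ex M hm hM
    rw [Function.iterate_one, one, hM]
    have hr : r ≤ m := (le_max_left _ _).trans hm
    simp only [Cmd.code, Cmd.entry, stepAux]
    rw [s.stk_ofNat hr, List.tail_replicate, s.update_reg hr, h]
    simp only [List.replicate_zero, List.head?_nil, Option.isSome_none, cond_false]
    -- The test of a loop pops the register; on an empty stack the pop changes nothing, in agreement
    -- with truncated subtraction.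
    rw [show 0 - 1 = s.regs r by omega, s.set_self]
  | @loop_succ r c s s' s'' n t t' h h1 h2 ih1 ih2 =>
    intro Λ emb ex M hm hM
    have hr : r ≤ m := (le_max_left _ _).trans hm
    rw [add_comm, Function.iterate_add_apply, add_comm 1 t, Function.iterate_succ_apply, one, hM]
    have h3 := ih1 (emb := fun l => emb (some l)) (ex := emb none) (M := M)
      ((le_max_right _ _).trans hm) (fun l => hM (some l))
    have h4 := ih2 (emb := emb) (ex := ex) (M := M) hm hM
    rw [← h4]
    refine congrArg _ (Eq.trans ?_ h3)
    refine congrArg _ (congrArg some ?_)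
    simp only [Cmd.code, Cmd.entry, stepAux]
    rw [s.stk_ofNat hr, List.tail_replicate, s.update_reg hr, h]
    simp [List.replicate_succ]
  | advance s =>
    intro Λ emb ex M hm hM
    rw [Function.iterate_one, one, hM]
    simp only [Cmd.code, stepAux]
    rw [s.update_inp]
    obtain ⟨regs, inp, bak, out⟩ := s
    cases inp with
    | nil => rfl
    | cons a l => exact congrArg (fun S => some (Cfg.mk _ _ S)) (Store.update_bak _ _)
  | read a r s =>
    intro Λ emb ex M hm hM
    change r ≤ m at hm
    rw [Function.iterate_one, one, hM]
    simp only [Cmd.code, stepAux]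
    have h1 : s.stk m .inp = s.inp := rfl
    rw [h1, s.stk_ofNat hm, ← List.replicate_succ, s.update_reg hm]
    by_cases h : s.inp.head? = some a
    · simp [h]
    · simp [h, s.set_self]
  | rewind s =>
    intro Λ emb ex M hm hM
    obtain ⟨regs, inp, bak, out⟩ := s
    -- One machine step per symbol moved, and one more to find the stack empty; hence the time
    -- `length + 1`, here and for `forward` and `clear`.
    dsimp only
    induction bak generalizing inp with
    | nil =>
      rw [List.length_nil, Function.iterate_one, one, hM]
      simp only [Cmd.code, stepAux]
      rw [Store.update_bak]
      rfl
    | cons a bak ih =>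
      have := ih (a :: inp)
      rw [List.length_cons, Function.iterate_succ_apply, one, hM, List.reverse_cons,
        List.append_assoc]
      refine Eq.trans (congrArg _ (congrArg some ?_)) this
      simp only [Cmd.code, stepAux]
      rw [Store.update_bak]
      exact congrArg (fun S => Cfg.mk _ _ S) (Store.update_inp _ _)
  | forward r s =>
    intro Λ emb ex M hm hM
    change r ≤ m at hm
    obtain ⟨regs, inp, bak, out⟩ := s
    dsimp only
    induction inp generalizing bak regs with
    | nil =>
      rw [List.length_nil, Function.iterate_one, one, hM]
      simp only [Cmd.code, stepAux]
      rw [Store.update_inp]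
      simp [Store.stk]
    | cons a inp ih =>
      have := ih (Function.update regs r (regs r + 1)) (a :: bak)
      rw [List.length_cons, Function.iterate_succ_apply, one, hM, List.reverse_cons,
        List.append_assoc]
      refine Eq.trans (congrArg _ (congrArg some ?_)) (this.trans ?_)
      · simp only [Cmd.code, stepAux]
        rw [Store.update_inp]
        have h1 := Store.update_bak (m := m) (B := B) ⟨regs, inp, bak, out⟩ (a :: bak)
        refine congrArg (fun S => Cfg.mk _ _ S) ?_
        refine Eq.trans (congrArg (fun S : (k : Stk m) → List (StkΓ A B m k) =>
          Function.update S (Stk.ofNat r) (List.cons (default : A) (S (Stk.ofNat r)))) h1) ?_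
        rw [Store.stk_ofNat _ hm, ← List.replicate_succ, Store.update_reg _ hm]
        rfl
      · simp [add_comm, add_left_comm]
  | clear s =>
    intro Λ emb ex M hm hM
    obtain ⟨regs, inp, bak, out⟩ := s
    dsimp only
    induction inp with
    | nil =>
      rw [List.length_nil, Function.iterate_one, one, hM]
      simp only [Cmd.code, stepAux]
      rw [Store.update_inp]
      rfl
    | cons a inp ih =>
      rw [List.length_cons, Function.iterate_succ_apply, one, hM]
      refine Eq.trans (congrArg _ (congrArg some ?_)) ih
      simp only [Cmd.code, stepAux]
      rw [Store.update_inp]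
      rfl
  | emit b s =>
    intro Λ emb ex M hm hM
    rw [Function.iterate_one, one, hM]
    simp only [Cmd.code, stepAux]
    rw [s.update_out]
    rfl

/-- The stack machine of a program. -/
noncomputable def Cmd.toFinTM2 [Fintype A] (c : Cmd A B) : Turing.FinTM2 :=
  letI := c.nonempty_fintype_lbl.some
  { K := Stk c.maxReg
    k₀ := .inp
    k₁ := .out
    Γ := StkΓ A B c.maxReg
    Λ := Option c.Lbl
    main := some c.entry
    σ := Option A
    initialState := none
    Γk₀Fin := inferInstanceAs (Fintype A)
    m := fun
      | none => .halt
      | some l => c.code c.maxReg some none l }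

/-- The store at the beginning of a computation. -/
def Store.init (l : List A) : Store A B := ⟨fun _ => 0, l, [], []⟩

theorem Run.outputs [Fintype A] {c : Cmd A B} {l : List A} {l' : List B} {t : ℕ}
    (h : Run c (Store.init l) t ⟨fun _ => 0, [], [], l'⟩) :
    Nonempty (Turing.TM2OutputsInTime c.toFinTM2 l (some l') (t + 1)) := by
  refine ⟨⟨⟨t + 1, ?_⟩, le_rfl⟩⟩
  have h1 := h.iterate_code (m := c.maxReg) (emb := some) (ex := none) (M := c.toFinTM2.m) le_rfl
    (fun _ => rfl)
  have h2 : Turing.initList c.toFinTM2 l =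
      ⟨some (some c.entry), none, (Store.init l : Store A B).stk c.maxReg⟩ := by
    refine congrArg (Turing.TM2.Cfg.mk _ _) (funext fun k => ?_)
    match k with
    | .inp => exact Turing.initList_stk_self c.toFinTM2 l
    | .bak => exact Turing.initList_stk_of_ne c.toFinTM2 l (k := Stk.bak) (by rintro ⟨⟩)
    | .out => exact Turing.initList_stk_of_ne c.toFinTM2 l (k := Stk.out) (by rintro ⟨⟩)
    | .reg r => exact Turing.initList_stk_of_ne c.toFinTM2 l (k := Stk.reg r) (by rintro ⟨⟩)
  have h3 : Turing.haltList c.toFinTM2 l' =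
      ⟨none, none, Store.stk c.maxReg (⟨fun _ => 0, [], [], l'⟩ : Store A B)⟩ := by
    refine congrArg (Turing.TM2.Cfg.mk _ _) (funext fun k => ?_)
    match k with
    | .inp => exact Turing.haltList_stk_of_ne c.toFinTM2 l' (k := Stk.inp) (by rintro ⟨⟩)
    | .bak => exact Turing.haltList_stk_of_ne c.toFinTM2 l' (k := Stk.bak) (by rintro ⟨⟩)
    | .out => exact Turing.haltList_stk_self c.toFinTM2 l'
    | .reg r => exact Turing.haltList_stk_of_ne c.toFinTM2 l' (k := Stk.reg r) (by rintro ⟨⟩)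
  -- The additional step executes `halt` at the exit label `none`. The result is a legal final
  -- configuration because registers and tapes are empty.
  rw [Function.iterate_succ_apply']
  refine Eq.trans (congrArg _ ((congrArg _ (congrArg some h2)).trans h1)) ?_
  exact congrArg some h3.symm

/-- A function is computable in polynomial time if a program computes it in polynomial time. -/
theorem nonempty_polyTime_of_run [Fintype A] {X Y : Type} {encX : X → List A} {encY : Y → List B}
    {f : X → Y} (c : Cmd A B) (T : Polynomial ℕ)
    (h : ∀ x, ∃ t ≤ T.eval (encX x).length,
      Run c (Store.init (encX x)) t ⟨fun _ => 0, [], [], encY (f x)⟩) :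
    Nonempty (Turing.TM2ComputableInPolyTime encX encY f) := by
  have key : ∀ x, Nonempty (Turing.TM2OutputsInTime c.toFinTM2 (encX x) (some (encY (f x)))
      ((T + 1).eval (encX x).length)) := by
    intro x
    obtain ⟨t, ht, hr⟩ := h x
    obtain ⟨ho⟩ := hr.outputs
    refine ⟨⟨ho.toEvalsTo, ho.steps_le_m.trans ?_⟩⟩
    simpa using ht
  refine ⟨{ tm := c.toFinTM2, inputAlphabet := Equiv.refl A, outputAlphabet := Equiv.refl B,
            time := T + 1, outputsFun := fun x => ?_ }⟩
  have := (key x).some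
  rw [← List.map_id (encX x), ← List.map_id (encY (f x)), List.length_map] at this
  exact this

end Compile

end RegisterProgram

/-! ## Functions that are computed by programs in polynomial time -/

namespace RegisterProgram

section Store

variable {A B : Type} (s : Store A B)

@[simp] theorem Store.set_set (r v w : ℕ) : (s.set r v).set r w = s.set r w := by
  simp [Store.set]

theorem Store.set_comm {r r' : ℕ} (h : r ≠ r') (v w : ℕ) :
    (s.set r v).set r' w = (s.set r' w).set r v := by
  simp [Store.set, Function.update_comm h]

theorem Store.set_eq_self {r v : ℕ} (h : s.regs r = v) : s.set r v = s := by
  subst h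
  exact s.set_self r

@[simp] theorem Store.set_regs_self (r v : ℕ) : (s.set r v).regs r = v := by
  simp [Store.set]

theorem Store.set_regs_of_ne {r r' : ℕ} (h : r' ≠ r) (v : ℕ) :
    (s.set r v).regs r' = s.regs r' := by
  simp [Store.set, Function.update_of_ne h]

end Store

/-! ### Loops with a decreasing counter. -/

section Loops

variable {A B : Type} [DecidableEq A]

/-- A loop that goes through the stores `S n, …, S 0`. -/
theorem Run.loop_of_body {r : ℕ} {c : Cmd A B} {τ : ℕ} (S : ℕ → Store A B) (n : ℕ)
    (hr : ∀ k ≤ n, (S k).regs r = k)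
    (hS : ∀ k < n, ∃ t ≤ τ, Run c ((S (k + 1)).set r k) t (S k)) :
    ∃ t ≤ n * (τ + 1) + 1, Run (.loop r c) (S n) t (S 0) := by
  induction n with
  | zero => exact ⟨1, by simp, .loop_zero (hr 0 le_rfl)⟩
  | succ n ih =>
    obtain ⟨t, ht, h⟩ := ih (fun k hk => hr k (by omega)) (fun k hk => hS k (by omega))
    obtain ⟨t', ht', h'⟩ := hS n (by omega)
    refine ⟨1 + t' + t, ?_, .loop_succ (hr _ le_rfl) h' h⟩
    rw [Nat.succ_mul]
    omega

theorem Run.loop_inc {r b : ℕ} (h : r ≠ b) (s : Store A B) (x n : ℕ) :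
    ∃ t ≤ 2 * n + 1,
      Run (.loop r (.inc b)) ((s.set b x).set r n) t ((s.set b (x + n)).set r 0) := by
  obtain ⟨t, ht, hr⟩ := Run.loop_of_body (r := r) (c := .inc b) (τ := 1)
    (fun k => (s.set b (x + (n - k))).set r k) n (fun k _ => by simp) (fun k hk => by
      refine ⟨1, le_rfl, ?_⟩
      have := Run.inc b ((s.set b (x + (n - (k + 1)))).set r k)
      rw [Store.set_regs_of_ne _ h.symm, Store.set_regs_self, Store.set_comm _ h,
        Store.set_set] at this
      simp only [Store.set_set]
      convert this using 3
      omega)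
  refine ⟨t, by omega, ?_⟩
  simpa using hr

theorem Run.loop_dec {r b : ℕ} (h : r ≠ b) (s : Store A B) (x n : ℕ) :
    ∃ t ≤ 2 * n + 1,
      Run (.loop r (.dec b)) ((s.set b x).set r n) t ((s.set b (x - n)).set r 0) := by
  obtain ⟨t, ht, hr⟩ := Run.loop_of_body (r := r) (c := .dec b) (τ := 1)
    (fun k => (s.set b (x - (n - k))).set r k) n (fun k _ => by simp) (fun k hk => by
      refine ⟨1, le_rfl, ?_⟩
      have := Run.dec b ((s.set b (x - (n - (k + 1)))).set r k)
      rw [Store.set_regs_of_ne _ h.symm, Store.set_regs_self, Store.set_comm _ h,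
        Store.set_set] at this
      simp only [Store.set_set]
      convert this using 3
      omega)
  refine ⟨t, by omega, ?_⟩
  simpa using hr

end Loops

/-- The elements of `α` are represented by a word on the input tape and by the values of `len`
registers. -/
class Env (A B : outParam Type) (α : Type) where
  /-- the word on the input tape -/
  word : α → List A
  /-- the number of registers -/
  len : ℕ
  /-- the values of the registers -/
  val : α → ℕ → ℕ

variable {A B : Type} {α : Type} [Env A B α]

/-- An additional register. -/
instance : Env A B (α × ℕ) where
  word p := Env.word p.1
  len := Env.len α + 1
  val p i := if i = Env.len α then p.2 else Env.val p.1 i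

/-- The size of an element: the length of its word plus the values of its registers. -/
def Env.size (a : α) : ℕ :=
  (Env.word a).length + ∑ i ∈ Finset.range (Env.len α), Env.val a i

theorem Env.size_prod (a : α) (x : ℕ) : Env.size (a, x) = Env.size a + x := by
  have h1 : Env.len (α × ℕ) = Env.len α + 1 := rfl
  unfold Env.size
  rw [h1, Finset.sum_range_succ, ← add_assoc]
  refine congrArg₂ _ (congrArg₂ _ rfl (Finset.sum_congr rfl fun i hi => ?_)) (if_pos rfl)
  exact if_neg (Finset.mem_range.1 hi).ne

/-- The store holds `a`, with registers given by `ρ`, and the registers from `b` on are free. -/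
structure Represents (s : Store A B) (ρ : ℕ → ℕ) (b : ℕ) (a : α) : Prop where
  inp : s.inp = Env.word a
  bak : s.bak = []
  lt : ∀ i < Env.len α, ρ i < b
  val : ∀ i < Env.len α, s.regs (ρ i) = Env.val a i
  zero : ∀ r, b ≤ r → s.regs r = 0

namespace Represents

variable {s : Store A B} {ρ : ℕ → ℕ} {b : ℕ} {a : α}

theorem set (h : Represents s ρ b a) (v : ℕ) : Represents (s.set b v) ρ (b + 1) a where
  inp := h.inp
  bak := h.bak
  lt i hi := (h.lt i hi).trans (Nat.lt_succ_self b)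
  val i hi := by rw [Store.set_regs_of_ne _ (h.lt i hi).ne, h.val i hi]
  zero r hr := by rw [Store.set_regs_of_ne _ (by omega), h.zero r (by omega)]

theorem succ (h : Represents s ρ b a) : Represents s ρ (b + 1) a := by
  have := h.set 0
  rwa [Store.set_eq_self _ (h.zero b le_rfl)] at this

theorem extend (h : Represents s ρ b a) (v : ℕ) :
    Represents (s.set b v) (Function.update ρ (Env.len α) b) (b + 1) (a, v) where
  inp := h.inp
  bak := h.bak
  lt i hi := by
    by_cases h1 : i = Env.len α
    · subst h1; simp
    · have : i < Env.len α := by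
        have h2 : i < Env.len α + 1 := hi
        omega
      rw [Function.update_of_ne h1]
      exact (h.lt i this).trans (Nat.lt_succ_self b)
  val i hi := by
    by_cases h1 : i = Env.len α
    · subst h1; simp [Env.val]
    · have : i < Env.len α := by
        have h2 : i < Env.len α + 1 := hi
        omega
      rw [Function.update_of_ne h1, Store.set_regs_of_ne _ (h.lt i this).ne, h.val i this]
      exact (if_neg h1).symm
  zero r hr := by rw [Store.set_regs_of_ne _ (by omega), h.zero r (by omega)]

theorem fst {p : α × ℕ} (h : Represents s ρ b p) : Represents s ρ b p.1 where
  inp := h.inp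
  bak := h.bak
  lt i hi := h.lt i (Nat.lt_succ_of_lt hi)
  val i hi := by
    rw [h.val i (Nat.lt_succ_of_lt hi)]
    exact if_neg hi.ne
  zero := h.zero

theorem out (h : Represents s ρ b a) (l : List B) : Represents { s with out := l } ρ b a where
  inp := h.inp
  bak := h.bak
  lt := h.lt
  val := h.val
  zero := h.zero

end Represents

variable [DecidableEq A]

/-- The function `f` is computed in polynomial time by a program: given the arguments in the
registers `ρ i`, the program puts the value into the register `b`. -/
def Comp (f : α → ℕ) : Prop :=
  ∃ (c : (ℕ → ℕ) → ℕ → Cmd A B) (T : Polynomial ℕ), ∀ a, f a ≤ T.eval (Env.size a) ∧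
    ∀ s ρ b, Represents s ρ b a → ∃ t ≤ T.eval (Env.size a), Run (c ρ b) s t (s.set b (f a))

namespace Comp

theorem zero : Comp fun _ : α => 0 :=
  ⟨fun _ _ => .skip, 1, fun a => ⟨by simp, fun s ρ b h => ⟨1, by simp, by
    rw [Store.set_eq_self _ (h.zero b le_rfl)]
    exact .skip s⟩⟩⟩

theorem one : Comp fun _ : α => 1 :=
  ⟨fun _ b => .inc b, 1, fun a => ⟨by simp, fun s ρ b h => ⟨1, by simp, by
    have := Run.inc b s
    rwa [h.zero b le_rfl] at this⟩⟩⟩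

theorem add {f g : α → ℕ} (hf : Comp f) (hg : Comp g) : Comp fun a => f a + g a := by
  obtain ⟨cf, Tf, hf⟩ := hf
  obtain ⟨cg, Tg, hg⟩ := hg
  refine ⟨fun ρ b => .seq (cf ρ b) (.seq (cg ρ (b + 1)) (.loop (b + 1) (.inc b))),
    Tf + 3 * Tg + 1, fun a => ?_⟩
  obtain ⟨hf1, hf2⟩ := hf a
  obtain ⟨hg1, hg2⟩ := hg a
  simp only [Polynomial.eval_add, Polynomial.eval_mul, Polynomial.eval_ofNat, Polynomial.eval_one]
  refine ⟨by omega, fun s ρ b h => ?_⟩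
  obtain ⟨t1, ht1, h1⟩ := hf2 s ρ b h
  obtain ⟨t2, ht2, h2⟩ := hg2 _ ρ (b + 1) (h.set (f a))
  obtain ⟨t3, ht3, h3⟩ := Run.loop_inc (A := A) (Nat.succ_ne_self b) s (f a) (g a)
  have e : (s.set b (f a + g a)).set b.succ 0 = s.set b (f a + g a) := Store.set_eq_self _ <| by
    rw [Store.set_regs_of_ne _ (Nat.succ_ne_self b), h.zero _ (Nat.le_succ b)]
  rw [e] at h3
  exact ⟨_, by omega, .seq h1 (.seq h2 h3)⟩

theorem sub {f g : α → ℕ} (hf : Comp f) (hg : Comp g) : Comp fun a => f a - g a := by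
  obtain ⟨cf, Tf, hf⟩ := hf
  obtain ⟨cg, Tg, hg⟩ := hg
  refine ⟨fun ρ b => .seq (cf ρ b) (.seq (cg ρ (b + 1)) (.loop (b + 1) (.dec b))),
    Tf + 3 * Tg + 1, fun a => ?_⟩
  obtain ⟨hf1, hf2⟩ := hf a
  obtain ⟨hg1, hg2⟩ := hg a
  simp only [Polynomial.eval_add, Polynomial.eval_mul, Polynomial.eval_ofNat, Polynomial.eval_one]
  refine ⟨by omega, fun s ρ b h => ?_⟩
  obtain ⟨t1, ht1, h1⟩ := hf2 s ρ b h
  obtain ⟨t2, ht2, h2⟩ := hg2 _ ρ (b + 1) (h.set (f a))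
  obtain ⟨t3, ht3, h3⟩ := Run.loop_dec (A := A) (Nat.succ_ne_self b) s (f a) (g a)
  have e : (s.set b (f a - g a)).set b.succ 0 = s.set b (f a - g a) := Store.set_eq_self _ <| by
    rw [Store.set_regs_of_ne _ (Nat.succ_ne_self b), h.zero _ (Nat.le_succ b)]
  rw [e] at h3
  exact ⟨_, by omega, .seq h1 (.seq h2 h3)⟩

theorem const (n : ℕ) : Comp fun _ : α => n := by
  induction n with
  | zero => exact zero
  | succ n ih => exact ih.add one

/-- Reading a register by a loop destroys it. The loop therefore makes two copies, in `b` and `b +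
1`, and the second one is used to restore the argument. -/
theorem snd : Comp fun p : α × ℕ => p.2 := by
  refine ⟨fun ρ b => .seq (.loop (ρ (Env.len α)) (.seq (.inc b) (.inc (b + 1))))
    (.loop (b + 1) (.inc (ρ (Env.len α)))), 5 * Polynomial.X + 2, fun p => ?_⟩
  have hsz : p.2 ≤ Env.size p := by
    rw [← Prod.mk.eta (p := p), Env.size_prod]
    exact Nat.le_add_left _ _
  simp only [Polynomial.eval_add, Polynomial.eval_mul, Polynomial.eval_ofNat, Polynomial.eval_X]
  refine ⟨by omega, fun s ρ b h => ?_⟩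
  have hx : ρ (Env.len α) < b := h.lt (Env.len α) (Nat.lt_succ_self _)
  have hv : s.regs (ρ (Env.len α)) = p.2 :=
    (h.val (Env.len α) (Nat.lt_succ_self _)).trans (if_pos rfl)
  generalize ρ (Env.len α) = x at hx hv
  generalize p.2 = n at hv hsz
  obtain ⟨t1, ht1, h1⟩ := Run.loop_of_body (A := A) (r := x) (c := .seq (.inc b) (.inc (b + 1)))
    (τ := 2) (fun k => ((s.set b (n - k)).set (b + 1) (n - k)).set x k) n
    (fun k _ => by simp) (fun k hk => by
      refine ⟨2, le_rfl, ?_⟩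
      have e1 := Run.inc (A := A) b (((s.set b (n - (k + 1))).set (b + 1) (n - (k + 1))).set x k)
      rw [Store.set_regs_of_ne _ hx.ne', Store.set_regs_of_ne _ (by omega), Store.set_regs_self,
        Store.set_comm _ hx.ne, Store.set_comm _ (Nat.succ_ne_self b), Store.set_set] at e1
      have e2 := Run.inc (A := A) (b + 1)
        (((s.set b (n - (k + 1) + 1)).set (b + 1) (n - (k + 1))).set x k)
      rw [Store.set_regs_of_ne _ (by omega), Store.set_regs_self,
        Store.set_comm _ (by omega : x ≠ b + 1), Store.set_set] at e2
      simp only [Store.set_set]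
      have e3 : n - k = n - (k + 1) + 1 := by omega
      rw [e3]
      exact e1.seq e2)
  obtain ⟨t2, ht2, h2⟩ := Run.loop_inc (A := A) (by omega : b + 1 ≠ x) (s.set b n) 0 n
  refine ⟨t1 + t2, by omega, ?_⟩
  have e1 : ((s.set b (n - n)).set (b + 1) (n - n)).set x n = s := by
    rw [Nat.sub_self, Store.set_eq_self s (h.zero b le_rfl),
      Store.set_eq_self s (h.zero _ (Nat.le_succ b)), Store.set_eq_self s hv]
  have e2 : ((s.set b n).set x (0 + n)).set (b + 1) 0 = s.set b n := by
    rw [Store.set_eq_self (s.set b n), Store.set_eq_self (s.set b n)]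
    · rw [Store.set_regs_of_ne _ (by omega), h.zero _ (Nat.le_succ b)]
    · rw [Store.set_regs_of_ne _ hx.ne, hv, zero_add]
  rw [e1] at h1
  rw [e2, Store.set_comm _ (by omega : x ≠ b + 1)] at h2
  exact h1.seq h2

theorem fst {f : α → ℕ} (hf : Comp f) : Comp fun p : α × ℕ => f p.1 := by
  obtain ⟨c, T, hf⟩ := hf
  refine ⟨c, T, fun p => ?_⟩
  have hsz : T.eval (Env.size p.1) ≤ T.eval (Env.size p) := by
    refine Polynomial.eval_mono_nat T ?_
    nth_rewrite 2 [← Prod.mk.eta (p := p)]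
    rw [Env.size_prod]
    exact Nat.le_add_right _ _
  refine ⟨(hf p.1).1.trans hsz, fun s ρ b h => ?_⟩
  obtain ⟨t, ht, hr⟩ := (hf p.1).2 s ρ b h.fst
  exact ⟨t, ht.trans hsz, hr⟩

/-- The only loop needed for arithmetic: products, bounded quantifiers, counting and division all
come from it. The counter `b + 1` decreases from `f a`, is itself the summation index passed to `g`,
and `b` accumulates the sum over `Ico k (f a)`. The time stays polynomial because `Comp` also bounds
values: the size of `(a, k)` is at most that of `a` plus `Tf`. -/
theorem sum_range {f : α → ℕ} {g : α → ℕ → ℕ} (hf : Comp f)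
    (hg : Comp fun p : α × ℕ => g p.1 p.2) :
    Comp fun a => ∑ i ∈ Finset.range (f a), g a i := by
  obtain ⟨cf, Tf, hf⟩ := hf
  obtain ⟨cg, Tg, hg⟩ := hg
  refine ⟨fun ρ b => .seq (cf ρ (b + 1)) (.loop (b + 1)
    (.seq (cg (Function.update ρ (Env.len α) (b + 1)) (b + 2)) (.loop (b + 2) (.inc b)))),
    Tf + Tf * (3 * Tg.comp (Polynomial.X + Tf) + 2) + 1, fun a => ?_⟩
  obtain ⟨hf1, hf2⟩ := hf a
  simp only [Polynomial.eval_add, Polynomial.eval_mul, Polynomial.eval_ofNat, Polynomial.eval_one,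
    Polynomial.eval_comp, Polynomial.eval_X]
  have hT : ∀ k < f a, Tg.eval (Env.size (a, k)) ≤
      Tg.eval (Env.size a + Tf.eval (Env.size a)) := by
    intro k hk
    rw [Env.size_prod]
    exact Polynomial.eval_mono_nat _ (by omega)
  generalize Tg.eval (Env.size a + Tf.eval (Env.size a)) = G at hT
  have hG : ∀ k < f a, g a k ≤ G := fun k hk => (hg (a, k)).1.trans (hT k hk)
  refine ⟨?_, fun s ρ b h => ?_⟩
  · have h1 : ∑ i ∈ Finset.range (f a), g a i ≤ f a * G := by
      have := Finset.sum_le_card_nsmul (Finset.range (f a)) (g a) G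
        (fun i hi => hG i (Finset.mem_range.1 hi))
      simpa using this
    have h2 : f a * G ≤ Tf.eval (Env.size a) * (3 * G + 2) := Nat.mul_le_mul hf1 (by omega)
    omega
  · obtain ⟨t1, ht1, h1⟩ := hf2 s ρ (b + 1) h.succ
    obtain ⟨t2, ht2, h2⟩ := Run.loop_of_body (A := A) (r := b + 1)
      (c := .seq (cg (Function.update ρ (Env.len α) (b + 1)) (b + 2)) (.loop (b + 2) (.inc b)))
      (τ := 3 * G + 1)
      (fun k => (s.set b (∑ i ∈ Finset.Ico k (f a), g a i)).set (b + 1) k) (f a)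
      (fun k _ => by simp) (fun k hk => by
        simp only [Store.set_set]
        obtain ⟨t3, ht3, h3⟩ := (hg (a, k)).2 _ _ _
          ((h.set (∑ i ∈ Finset.Ico (k + 1) (f a), g a i)).extend k)
        obtain ⟨t4, ht4, h4⟩ := Run.loop_inc (A := A) (by omega : b + 2 ≠ b) (s.set (b + 1) k)
          (∑ i ∈ Finset.Ico (k + 1) (f a), g a i) (g a k)
        have e1 := hG k hk
        have e2 := hT k hk
        refine ⟨t3 + t4, by omega, h3.seq ?_⟩
        rw [Store.set_comm _ (by omega : b + 1 ≠ b), Store.set_comm _ (by omega : b + 1 ≠ b)] at h4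
        rw [Finset.sum_eq_sum_Ico_succ_bot hk, add_comm (g a k)]
        refine Eq.subst (motive := Run _ _ _) (Store.set_eq_self _ ?_) h4
        rw [Store.set_regs_of_ne _ (by omega), Store.set_regs_of_ne _ (by omega),
          h.zero _ (by omega)])
    refine ⟨t1 + t2, ?_, h1.seq ?_⟩
    · have := ht2.trans (Nat.add_le_add_right (Nat.mul_le_mul_right (3 * G + 2) hf1) 1)
      omega
    · rw [Finset.Ico_self, Finset.sum_empty, Store.set_eq_self s (h.zero b le_rfl),
        Nat.Ico_zero_eq_range, Store.set_eq_self (s.set _ _)] at h2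
      · exact h2
      · rw [Store.set_regs_of_ne _ (by omega), h.zero _ (by omega)]

theorem mul {f g : α → ℕ} (hf : Comp f) (hg : Comp g) : Comp fun a => f a * g a := by
  have := hf.sum_range (g := fun a _ => g a) hg.fst
  simpa using this

theorem pow {f : α → ℕ} (hf : Comp f) (n : ℕ) : Comp fun a => f a ^ n := by
  induction n with
  | zero => simpa using const 1
  | succ n ih => simpa only [pow_succ] using ih.mul hf

theorem length : Comp fun a : α => (Env.word a).length := by
  refine ⟨fun _ b => .seq (.forward b) .rewind, 2 * Polynomial.X + 2, fun a => ?_⟩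
  have hsz : (Env.word a).length ≤ Env.size a := Nat.le_add_right _ _
  simp only [Polynomial.eval_add, Polynomial.eval_mul, Polynomial.eval_ofNat, Polynomial.eval_X]
  refine ⟨by omega, fun s ρ b h => ?_⟩
  obtain ⟨regs, inp, bak, out⟩ := s
  obtain rfl := h.inp
  obtain rfl := h.bak
  have hz : regs b = 0 := h.zero b le_rfl
  refine ⟨_, ?_, Eq.subst (motive := Run _ _ _) ?_
    ((Run.forward (A := A) b _).seq (Run.rewind _))⟩
  · simp only [List.length_append, List.length_reverse, List.length_nil]
    omega
  · simp [Store.set, hz]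

end Comp

open Classical in
/-- A predicate that is decided in polynomial time by a program. -/
def CompP (p : α → Prop) : Prop :=
  Comp fun a => if p a then 1 else 0

-- The head advances `f a` times, reads and is rewound. At the end of the word it stays put and
-- reads nothing, which matches the value `none` of `[·]?` there.
open Classical in
theorem Comp.read {f : α → ℕ} (hf : Comp f) (x : A) :
    CompP fun a => (Env.word a)[f a]? = some x := by
  obtain ⟨cf, Tf, hf⟩ := hf
  refine ⟨fun ρ b => .seq (cf ρ (b + 1)) (.seq (.loop (b + 1) .advance)
    (.seq (.read x b) .rewind)), 3 * Tf + Polynomial.X + 4, fun a => ?_⟩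
  obtain ⟨hf1, hf2⟩ := hf a
  have hsz : (Env.word a).length ≤ Env.size a := Nat.le_add_right _ _
  simp only [Polynomial.eval_add, Polynomial.eval_mul, Polynomial.eval_ofNat, Polynomial.eval_X]
  refine ⟨by split_ifs <;> omega, fun s ρ b h => ?_⟩
  obtain ⟨t1, ht1, h1⟩ := hf2 s ρ (b + 1) h.succ
  obtain ⟨regs, inp, bak, out⟩ := s
  obtain rfl := h.inp
  obtain rfl := h.bak
  have hz : regs b = 0 := h.zero b le_rfl
  have hz' : regs (b + 1) = 0 := h.zero _ (Nat.le_succ b)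
  obtain ⟨t2, ht2, h2⟩ := Run.loop_of_body (A := A) (r := b + 1) (c := .advance) (τ := 1)
    (fun k => (⟨Function.update regs (b + 1) k, (Env.word a).drop (f a - k),
      ((Env.word a).take (f a - k)).reverse, out⟩ : Store A B)) (f a)
    (fun k _ => by simp) (fun k hk => by
      refine ⟨1, le_rfl, Eq.subst (motive := Run _ _ _) ?_ (Run.advance _)⟩
      have e : f a - k = (f a - (k + 1)) + 1 := by omega
      cases h : (Env.word a)[f a - (k + 1)]? <;>
      simp [Store.set, e, List.take_add_one, List.tail_drop, h])
  rw [Nat.sub_self, Nat.sub_zero] at h2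
  refine ⟨_, ?_, Eq.subst (motive := Run _ _ _) ?_
    (h1.seq (h2.seq ((Run.read (A := A) x b _).seq (Run.rewind _))))⟩
  · simp only [Store.set, List.length_reverse, List.length_take]
    omega
  · rw [Function.update_eq_self_iff.2 hz'.symm]
    simp only [Store.set, hz, zero_add,
      List.reverse_reverse, List.take_append_drop, List.head?_drop]
    congr

/-! ### Predicates as functions with values 0 and 1. -/

section Predicates

open Classical in
theorem CompP.congr {p q : α → Prop} (hp : CompP p) (h : ∀ a, p a ↔ q a) : CompP q := by
  have : p = q := funext fun a => propext (h a)
  rwa [← this]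

theorem Comp.pos {f : α → ℕ} (hf : Comp f) : CompP fun a => 0 < f a := by
  -- With truncated subtraction, `1 - (1 - x)` is the indicator of `0 < x`.
  have h := (Comp.const 1).sub ((Comp.const 1).sub hf)
  refine Eq.subst (motive := Comp) (funext fun a => ?_) h
  split_ifs <;> omega

theorem CompP.not {p : α → Prop} (hp : CompP p) : CompP fun a => ¬ p a := by
  have h := (Comp.const 1).sub hp
  refine Eq.subst (motive := Comp) (funext fun a => ?_) h
  split_ifs <;> first | rfl | contradiction

theorem CompP.and {p q : α → Prop} (hp : CompP p) (hq : CompP q) : CompP fun a => p a ∧ q a := by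
  refine (Comp.pos (Comp.mul hp hq)).congr fun a => ?_
  by_cases h1 : p a <;> by_cases h2 : q a <;> simp [h1, h2]

theorem CompP.or {p q : α → Prop} (hp : CompP p) (hq : CompP q) : CompP fun a => p a ∨ q a := by
  refine (Comp.pos (Comp.add hp hq)).congr fun a => ?_
  by_cases h1 : p a <;> by_cases h2 : q a <;> simp [h1, h2]

theorem CompP.imp {p q : α → Prop} (hp : CompP p) (hq : CompP q) : CompP fun a => p a → q a :=
  (hp.not.or hq).congr fun _ => imp_iff_not_or.symm

theorem CompP.true : CompP fun _ : α => True :=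
  (Comp.pos (Comp.const 1)).congr fun _ => by simp

theorem Comp.lt {f g : α → ℕ} (hf : Comp f) (hg : Comp g) : CompP fun a => f a < g a :=
  (hg.sub hf).pos.congr fun _ => by omega

theorem Comp.le {f g : α → ℕ} (hf : Comp f) (hg : Comp g) : CompP fun a => f a ≤ g a :=
  (hg.lt hf).not.congr fun _ => by omega

theorem Comp.eq {f g : α → ℕ} (hf : Comp f) (hg : Comp g) : CompP fun a => f a = g a :=
  ((hf.le hg).and (hg.le hf)).congr fun _ => by omega

theorem Comp.exists_lt {f : α → ℕ} {p : α → ℕ → Prop} (hf : Comp f)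
    (hp : CompP fun x : α × ℕ => p x.1 x.2) : CompP fun a => ∃ i < f a, p a i := by
  classical
  refine (Comp.pos (hf.sum_range (g := fun a i => if p a i then 1 else 0) ?_)).congr fun a => ?_
  · refine Eq.subst (motive := Comp) (funext fun a => ?_) hp
    congr
  · simp [Finset.Nonempty]

theorem Comp.forall_lt {f : α → ℕ} {p : α → ℕ → Prop} (hf : Comp f)
    (hp : CompP fun x : α × ℕ => p x.1 x.2) : CompP fun a => ∀ i < f a, p a i :=
  (hf.exists_lt (p := fun a i => ¬ p a i) hp.not).not.congr fun a => by simp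

/-- A conjunction over a fixed number of predicates. -/
theorem CompP.forall_lt_const {n : ℕ} {p : ℕ → α → Prop} (hp : ∀ i < n, CompP (p i)) :
    CompP fun a => ∀ i < n, p i a := by
  induction n with
  | zero => exact CompP.true.congr fun a => by simp
  | succ n ih =>
    refine ((ih fun i hi => hp i (by omega)).and (hp n (by omega))).congr fun a => ?_
    rw [Nat.forall_lt_succ_right]

/-- A disjunction over a fixed number of predicates. -/
theorem CompP.exists_lt_const {n : ℕ} {p : ℕ → α → Prop} (hp : ∀ i < n, CompP (p i)) :
    CompP fun a => ∃ i < n, p i a :=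
  (CompP.forall_lt_const (p := fun i a => ¬ p i a) fun i hi => (hp i hi).not).not.congr
    fun a => by simp

open Classical in
theorem CompP.ite {p : α → Prop} {f g : α → ℕ} (hp : CompP p) (hf : Comp f) (hg : Comp g) :
    Comp fun a => if p a then f a else g a := by
  have h := (Comp.mul hp hf).add (Comp.mul hp.not hg)
  refine Eq.subst (motive := Comp) (funext fun a => ?_) h
  by_cases h1 : p a <;> simp [h1]

open Classical in
theorem Comp.card_filter_range {f : α → ℕ} {p : α → ℕ → Prop} (hf : Comp f)
    (hp : CompP fun x : α × ℕ => p x.1 x.2) :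
    Comp fun a => ((Finset.range (f a)).filter (p a)).card := by
  simp only [Finset.card_filter]
  exact hf.sum_range (g := fun a i => if p a i then 1 else 0) hp

theorem Comp.min {f g : α → ℕ} (hf : Comp f) (hg : Comp g) : Comp fun a => min (f a) (g a) := by
  classical
  refine Eq.subst (motive := Comp) (funext fun a => ?_) ((hf.le hg).ite hf hg)
  rw [min_def]
  congr

theorem Comp.div {f g : α → ℕ} (hf : Comp f) (hg : Comp g) : Comp fun a => f a / g a := by
  classical
  -- The quotient is the number of positive multiples of `g a` up to `f a`. The condition `0 < g a`
  -- makes the count 0 for the divisor 0, as division requires.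
  have h := hf.card_filter_range (p := fun a i => 0 < g a ∧ (i + 1) * g a ≤ f a)
    ((Comp.pos hg.fst).and (((Comp.snd.add (Comp.const 1)).mul hg.fst).le hf.fst))
  refine Eq.subst (motive := Comp) (funext fun a => ?_) h
  rcases Nat.eq_zero_or_pos (g a) with h0 | h0
  · simp [h0]
  · have : (Finset.range (f a)).filter (fun i => 0 < g a ∧ (i + 1) * g a ≤ f a) =
        Finset.range (f a / g a) := by
      ext i
      simp only [Finset.mem_filter, Finset.mem_range, h0, true_and]
      rw [← Nat.le_div_iff_mul_le h0, Nat.succ_le_iff]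
      exact ⟨fun h => h.2, fun h => ⟨h.trans_le (Nat.div_le_self _ _), h⟩⟩
    convert congrArg Finset.card this
    simp

theorem Comp.mod {f g : α → ℕ} (hf : Comp f) (hg : Comp g) : Comp fun a => f a % g a := by
  refine Eq.subst (motive := Comp) (funext fun a => ?_) (hf.sub (hg.mul (hf.div hg)))
  have := Nat.div_add_mod (f a) (g a)
  omega

end Predicates

/-- The word `g a` is written on the output stack in polynomial time by a program. -/
def Emits (g : α → List B) : Prop :=
  ∃ (c : (ℕ → ℕ) → ℕ → Cmd A B) (T : Polynomial ℕ), ∀ a s ρ b, Represents s ρ b a →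
    ∃ t ≤ T.eval (Env.size a), Run (c ρ b) s t { s with out := g a ++ s.out }

namespace Emits

theorem singleton (x : B) : Emits fun _ : α => [x] :=
  ⟨fun _ _ => .emit x, 1, fun _ s _ _ _ => ⟨1, by simp, .emit x s⟩⟩

/-- The output is a stack whose top is the first symbol, so the second word is written first. -/
theorem append {g g' : α → List B} (h : Emits g) (h' : Emits g') :
    Emits fun a => g a ++ g' a := by
  obtain ⟨c, T, h⟩ := h
  obtain ⟨c', T', h'⟩ := h'
  refine ⟨fun ρ b => .seq (c' ρ b) (c ρ b), T' + T, fun a s ρ b hs => ?_⟩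
  obtain ⟨t', ht', hr'⟩ := h' a s ρ b hs
  obtain ⟨t, ht, hr⟩ := h a _ ρ b (hs.out (g' a ++ s.out))
  refine ⟨t' + t, ?_, ?_⟩
  · rw [Polynomial.eval_add]
    omega
  · rw [List.append_assoc]
    exact hr'.seq hr

/-- A decreasing counter produces the last block first, which is the order that the output stack
needs. -/
theorem flatMap_range {f : α → ℕ} {g : α → ℕ → List B} (hf : Comp f)
    (hg : Emits fun p : α × ℕ => g p.1 p.2) :
    Emits fun a => (List.range (f a)).flatMap (g a) := by
  obtain ⟨cf, Tf, hf⟩ := hf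
  obtain ⟨cg, Tg, hg⟩ := hg
  refine ⟨fun ρ b => .seq (cf ρ b) (.loop b (cg (Function.update ρ (Env.len α) b) (b + 1))),
    Tf + Tf * (Tg.comp (Polynomial.X + Tf) + 1) + 1, fun a s ρ b h => ?_⟩
  obtain ⟨hf1, hf2⟩ := hf a
  simp only [Polynomial.eval_add, Polynomial.eval_mul, Polynomial.eval_one,
    Polynomial.eval_comp, Polynomial.eval_X]
  have hT : ∀ k < f a, Tg.eval (Env.size (a, k)) ≤
      Tg.eval (Env.size a + Tf.eval (Env.size a)) := by
    intro k hk
    rw [Env.size_prod]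
    exact Polynomial.eval_mono_nat _ (by omega)
  generalize Tg.eval (Env.size a + Tf.eval (Env.size a)) = G at hT
  obtain ⟨t1, ht1, h1⟩ := hf2 s ρ b h
  obtain ⟨t2, ht2, h2⟩ := Run.loop_of_body (A := A) (r := b)
    (c := cg (Function.update ρ (Env.len α) b) (b + 1)) (τ := G)
    (fun k => { s.set b k with out := (List.range' k (f a - k)).flatMap (g a) ++ s.out }) (f a)
    (fun k _ => by simp [Store.set]) (fun k hk => by
      obtain ⟨t, ht, hr⟩ := hg (a, k) _ _ _
        ((h.extend k).out ((List.range' (k + 1) (f a - (k + 1))).flatMap (g a) ++ s.out))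
      refine ⟨t, ht.trans (hT k hk), ?_⟩
      have e : f a - k = f a - (k + 1) + 1 := by omega
      rw [e, List.range'_succ]
      simpa [Store.set] using hr)
  refine ⟨t1 + t2, ?_, h1.seq (Eq.subst (motive := fun s => Run _ s _ _) ?_
    (Eq.subst (motive := Run _ _ _) ?_ h2))⟩
  · have := ht2.trans (Nat.add_le_add_right (Nat.mul_le_mul_right (G + 1) hf1) 1)
    omega
  · simp [Store.set]
  · rw [Store.set_eq_self s (h.zero b le_rfl), List.range_eq_range', Nat.sub_zero]

open Classical in
theorem ite {p : α → Prop} (hp : CompP p) (x y : B) :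
    Emits fun a => [if p a then x else y] := by
  -- A branch is a loop whose number of rounds is the indicator, 0 or 1, of the condition.
  have h := (flatMap_range hp (g := fun _ _ => [x]) (singleton x)).append
    (flatMap_range hp.not (g := fun _ _ => [y]) (singleton y))
  refine Eq.subst (motive := Emits) (funext fun a => ?_) h
  by_cases h1 : p a <;> simp [h1]

theorem replicate {f : α → ℕ} (hf : Comp f) (x : B) : Emits fun a => List.replicate (f a) x := by
  refine Eq.subst (motive := Emits) (funext fun a => ?_)
    (flatMap_range hf (g := fun _ _ => [x]) (singleton x))
  rw [← List.map_eq_flatMap]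
  simp

/-- A program computes a function in polynomial time if it writes the values of the function, given
only the argument on the input tape. -/
theorem nonempty_polyTime [Fintype A] [Inhabited A] {Y : Type} {encY : Y → List B} {f : α → Y}
    (h : Emits fun a : α => encY (f a)) (hlen : Env.len α = 0) :
    Nonempty (Turing.TM2ComputableInPolyTime (Env.word (α := α)) encY f) := by
  obtain ⟨c, T, h⟩ := h
  refine nonempty_polyTime_of_run (.seq (c id 0) .clear) (T + Polynomial.X + 1) fun a => ?_
  have hsz : Env.size a = (Env.word a).length := by simp [Env.size, hlen]
  obtain ⟨t, ht, hr⟩ := h a (Store.init (Env.word a)) id 0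
    ⟨rfl, rfl, by simp [hlen], by simp [hlen], fun _ _ => rfl⟩
  refine ⟨_, ?_, Eq.subst (motive := Run _ _ _) ?_ (hr.seq (Run.clear _))⟩
  · rw [hsz] at ht
    simp only [Polynomial.eval_add, Polynomial.eval_X, Polynomial.eval_one, Store.init]
    omega
  · simp [Store.init]

end Emits

end RegisterProgram

/-! ## A graph whose induced matchings select candidates that agree on bits -/

namespace ParamComplexity

theorem hasInducedMatching_iff {V : Type} {G : SimpleGraph V} {k : ℕ} :
    HasInducedMatching G k ↔
      ∃ X : Finset V, X.card = 2 * k ∧ ∀ v ∈ X, ∃! w, w ∈ X ∧ G.Adj v w := by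
  refine exists_congr fun X => and_congr_right fun _ => ?_
  simp only [SimpleGraph.Subgraph.IsMatching, SimpleGraph.Subgraph.induce_verts,
    SimpleGraph.Subgraph.induce_adj, SimpleGraph.Subgraph.top_adj, Finset.mem_coe]
  refine forall₂_congr fun v hv => ?_
  simp [hv]

/-- Vertices outside the range of `φ` are isolated, and an isolated vertex is in no induced
matching. This cuts the selection graph, defined on all triples, down to a finite graph. -/
theorem hasInducedMatching_comap {V W : Type} {H : SimpleGraph W} {φ : V → W}
    (hφ : Function.Injective φ) (hH : ∀ u v, H.Adj u v → u ∈ Set.range φ) (k : ℕ) :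
    HasInducedMatching (H.comap φ) k ↔ HasInducedMatching H k := by
  classical
  rw [hasInducedMatching_iff, hasInducedMatching_iff]
  constructor
  · rintro ⟨X, hX, hm⟩
    refine ⟨X.image φ, by rw [Finset.card_image_of_injective _ hφ, hX], fun v hv => ?_⟩
    obtain ⟨v, hv', rfl⟩ := Finset.mem_image.1 hv
    obtain ⟨w, ⟨hw, hvw⟩, hu⟩ := hm v hv'
    refine ⟨φ w, ⟨Finset.mem_image_of_mem _ hw, hvw⟩, ?_⟩
    rintro y ⟨hy, hvy⟩
    obtain ⟨y, hy', rfl⟩ := Finset.mem_image.1 hy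
    rw [hu y ⟨hy', hvy⟩]
  · rintro ⟨X, hX, hm⟩
    have hsub : ∀ v ∈ X, v ∈ Set.range φ := fun v hv => by
      obtain ⟨w, ⟨-, hw⟩, -⟩ := hm v hv
      exact hH v w hw
    have himg : (X.preimage φ hφ.injOn).image φ = X := by
      ext v
      simp only [Finset.mem_image, Finset.mem_preimage]
      constructor
      · rintro ⟨u, hu, rfl⟩
        exact hu
      · intro hv
        obtain ⟨u, rfl⟩ := hsub v hv
        exact ⟨u, hv, rfl⟩
    refine ⟨X.preimage φ hφ.injOn, ?_, fun v hv => ?_⟩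
    · rw [← hX, ← Finset.card_image_of_injective _ hφ, himg]
    · rw [Finset.mem_preimage] at hv
      obtain ⟨w, ⟨hw, hvw⟩, hu⟩ := hm _ hv
      obtain ⟨w, rfl⟩ := hsub w hw
      refine ⟨w, ⟨Finset.mem_preimage.2 hw, hvw⟩, ?_⟩
      rintro y ⟨hy, hvy⟩
      exact hφ (hu _ ⟨Finset.mem_preimage.1 hy, hvy⟩)

/-! ### Stars, triangles and conflicts. -/

section Selection

variable (Y : ℕ) (good : ℕ → ℕ → Prop) (Bs : Finset (ℕ × ℕ)) (conf : ℕ → ℕ → ℕ → ℕ → ℕ → Prop)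

/-- The arcs of the selection graph: the center `(0, j, 0)` of the block `j` is joined to the good
candidates `(1, j, c)`, the vertices `(2, s, P)`, `(3, s, P)`, `(4, s, P)` of a bit form a triangle,
and a candidate is joined to the bit values `(2 + β, s, P)` with which it is in conflict. -/
def SelArc (u v : ℕ × ℕ × ℕ) : Prop :=
  (u.1 = 0 ∧ v.1 = 1 ∧ v.2.1 = u.2.1 ∧ u.2.2 = 0 ∧ u.2.1 < Y ∧ good u.2.1 v.2.2) ∨
  (u.1 = 1 ∧ u.2.1 < Y ∧ good u.2.1 u.2.2 ∧ v.2 ∈ Bs ∧ (v.1 = 2 ∨ v.1 = 3) ∧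
    conf u.2.1 u.2.2 v.2.1 v.2.2 (v.1 - 2)) ∨
  (2 ≤ u.1 ∧ u.1 < v.1 ∧ v.1 ≤ 4 ∧ v.2 = u.2 ∧ u.2 ∈ Bs)

/-- The selection graph. -/
def selGraph : SimpleGraph (ℕ × ℕ × ℕ) where
  Adj u v := SelArc Y good Bs conf u v ∨ SelArc Y good Bs conf v u
  symm := ⟨fun _ _ h => Or.symm h⟩
  loopless := ⟨fun u h => by
    have : ¬ SelArc Y good Bs conf u u := by
      unfold SelArc
      omega
    exact h.elim this this⟩

variable {Y good Bs conf}

theorem selGraph_adj_center {j b : ℕ} {w : ℕ × ℕ × ℕ}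
    (h : (selGraph Y good Bs conf).Adj (0, j, b) w) :
    b = 0 ∧ j < Y ∧ ∃ c, good j c ∧ w = (1, j, c) := by
  obtain ⟨τ, A, B⟩ := w
  rcases h with h | h
  · rcases h with ⟨-, h1, h2, h3, h4, h5⟩ | ⟨h1, -⟩ | ⟨h1, -⟩
    · dsimp only at h1 h2 h3 h4 h5
      subst h1 h2
      exact ⟨h3, h4, B, h5, rfl⟩
    · cases h1
    · dsimp only at h1; omega
  · rcases h with ⟨-, h1, -⟩ | ⟨-, -, -, -, h1, -⟩ | ⟨h0, h1, -⟩
    · cases h1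
    · dsimp only at h1; omega
    · dsimp only at h1; omega

theorem selGraph_adj_cand {j c : ℕ} {w : ℕ × ℕ × ℕ}
    (h : (selGraph Y good Bs conf).Adj (1, j, c) w) :
    j < Y ∧ good j c ∧ (w = (0, j, 0) ∨
      ∃ b ∈ Bs, ∃ β < 2, w = (2 + β, b) ∧ conf j c b.1 b.2 β) := by
  obtain ⟨τ, A, B⟩ := w
  rcases h with h | h
  · rcases h with ⟨h1, -⟩ | ⟨-, h1, h2, h3, h4, h5⟩ | ⟨h1, -⟩
    · cases h1
    · dsimp only at h1 h2 h3 h4 h5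
      refine ⟨h1, h2, .inr ⟨_, h3, τ - 2, by omega, ?_, h5⟩⟩
      rw [show 2 + (τ - 2) = τ by omega]
    · dsimp only at h1; omega
  · rcases h with ⟨h1, -, h2, h3, h4, h5⟩ | ⟨-, -, -, -, h1, -⟩ | ⟨h0, h1, -⟩
    · dsimp only at h1 h2 h3 h4 h5
      subst h1 h2 h3
      exact ⟨h4, h5, .inl rfl⟩
    · dsimp only at h1; omega
    · dsimp only at h1; omega

theorem selGraph_adj_bit {τ : ℕ} {b : ℕ × ℕ} {w : ℕ × ℕ × ℕ} (hτ : 2 ≤ τ)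
    (h : (selGraph Y good Bs conf).Adj (τ, b) w) :
    τ ≤ 4 ∧ b ∈ Bs ∧ (w.1 = 1 ∨ ∃ τ', 2 ≤ τ' ∧ τ' ≤ 4 ∧ τ' ≠ τ ∧ w = (τ', b)) := by
  obtain ⟨τ', b'⟩ := w
  rcases h with h | h
  · rcases h with ⟨h1, -⟩ | ⟨h1, -⟩ | ⟨h1, h2, h3, h4, h5⟩
    · dsimp only at h1; omega
    · dsimp only at h1; omega
    · dsimp only at h1 h2 h3 h4 h5
      subst h4
      exact ⟨by omega, h5, .inr ⟨τ', by omega, h3, by omega, rfl⟩⟩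
  · rcases h with ⟨-, h1, -⟩ | ⟨h1, -, -, h2, h3, -⟩ | ⟨h1, h2, h3, h4, h5⟩
    · dsimp only at h1; omega
    · dsimp only at h1 h2 h3
      exact ⟨by omega, h2, .inl h1⟩
    · dsimp only at h1 h2 h3 h4 h5
      subst h4
      exact ⟨by omega, h5, .inr ⟨τ', by omega, by omega, by omega, rfl⟩⟩

theorem selGraph_adj_center_cand {j c : ℕ} (hj : j < Y) (hc : good j c) :
    (selGraph Y good Bs conf).Adj (0, j, 0) (1, j, c) :=
  .inl (.inl ⟨rfl, rfl, rfl, rfl, hj, hc⟩)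

theorem selGraph_adj_cand_bit {j c β : ℕ} {b : ℕ × ℕ} (hj : j < Y) (hc : good j c) (hb : b ∈ Bs)
    (hβ : β < 2) (h : conf j c b.1 b.2 β) :
    (selGraph Y good Bs conf).Adj (1, j, c) (2 + β, b) := by
  refine .inl (.inr (.inl ⟨rfl, hj, hc, hb, ?_, ?_⟩))
  · dsimp only; omega
  · dsimp only
    rwa [show 2 + β - 2 = β by omega]

theorem selGraph_adj_triangle {τ τ' : ℕ} {b : ℕ × ℕ} (hb : b ∈ Bs) (h : 2 ≤ τ) (h4 : τ ≤ 4)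
    (h' : 2 ≤ τ') (h4' : τ' ≤ 4) (hne : τ ≠ τ') :
    (selGraph Y good Bs conf).Adj (τ, b) (τ', b) := by
  rcases lt_or_gt_of_ne hne with hlt | hlt
  · exact .inl (.inr (.inr ⟨h, hlt, h4', rfl, hb⟩))
  · exact .inr (.inr (.inr ⟨h', hlt, h4, rfl, hb⟩))

/-- The edges are center–chosen candidate in each block and chosen value–spare vertex `(4, b)` in
each triangle. Candidates are pairwise nonadjacent and spare vertices have no neighbors among them,
so another edge could only join a chosen candidate to a chosen value; that would be a conflict. -/
theorem hasInducedMatching_selGraph_of_assignment (a : ℕ × ℕ → ℕ) (ha : ∀ b, a b < 2) (c : ℕ → ℕ)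
    (hc : ∀ j < Y, good j (c j) ∧ ∀ b ∈ Bs, ¬ conf j (c j) b.1 b.2 (a b)) :
    HasInducedMatching (selGraph Y good Bs conf) (Y + Bs.card) := by
  classical
  rw [hasInducedMatching_iff]
  let X₀ : Finset (ℕ × ℕ × ℕ) := (Finset.range Y).image fun j => (0, j, 0)
  let X₁ : Finset (ℕ × ℕ × ℕ) := (Finset.range Y).image fun j => (1, j, c j)
  let X₂ : Finset (ℕ × ℕ × ℕ) := Bs.image fun b => (2 + a b, b)
  let X₄ : Finset (ℕ × ℕ × ℕ) := Bs.image fun b => (4, b)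
  have hX : ∀ v, v ∈ (X₀ ∪ X₁) ∪ (X₂ ∪ X₄) ↔ ((∃ j < Y, v = (0, j, 0)) ∨ ∃ j < Y, v = (1, j, c j)) ∨
      ((∃ b ∈ Bs, v = (2 + a b, b)) ∨ ∃ b ∈ Bs, v = (4, b)) := by
    intro v
    simp only [X₀, X₁, X₂, X₄, Finset.mem_union, Finset.mem_image, Finset.mem_range, eq_comm]
  refine ⟨(X₀ ∪ X₁) ∪ (X₂ ∪ X₄), ?_, fun v hv => ?_⟩
  · have hd : ∀ {s t : Finset (ℕ × ℕ × ℕ)}, (∀ u ∈ s, ∀ v ∈ t, u.1 ≠ v.1) → Disjoint s t :=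
      fun h => Finset.disjoint_left.2 fun u hu hv => h u hu u hv rfl
    have h0 : ∀ u ∈ X₀, u.1 = 0 := by simp [X₀]
    have h1 : ∀ u ∈ X₁, u.1 = 1 := by simp [X₁]
    have h2 : ∀ u ∈ X₂, 2 ≤ u.1 ∧ u.1 < 4 := by
      intro u hu
      obtain ⟨b, -, rfl⟩ := Finset.mem_image.1 hu
      have := ha b
      dsimp only
      omega
    have h4 : ∀ u ∈ X₄, u.1 = 4 := by
      intro u hu
      obtain ⟨b, -, rfl⟩ := Finset.mem_image.1 hu
      rfl
    rw [Finset.card_union_of_disjoint, Finset.card_union_of_disjoint, Finset.card_union_of_disjoint,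
      Finset.card_image_of_injective, Finset.card_image_of_injective,
      Finset.card_image_of_injective, Finset.card_image_of_injective, Finset.card_range]
    · ring
    · intro b b' h; simpa using h
    · intro b b' h
      exact congrArg (fun v : ℕ × ℕ × ℕ => v.2) h
    · intro j j' h
      exact congrArg (fun v : ℕ × ℕ × ℕ => v.2.1) h
    · intro j j' h; simpa using h
    · refine hd fun u hu v hv => ?_
      have := h2 u hu
      have := h4 v hv
      omega
    · refine hd fun u hu v hv => ?_
      have := h0 u hu
      have := h1 v hv
      omega
    · refine hd fun u hu v hv => ?_
      rcases Finset.mem_union.1 hu with hu | hu <;> rcases Finset.mem_union.1 hv with hv | hv <;>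
      [have := h0 u hu; have := h0 u hu; have := h1 u hu; have := h1 u hu] <;>
      [have := h2 v hv; have := h4 v hv; have := h2 v hv; have := h4 v hv] <;> omega
  · rcases (hX v).1 hv with (⟨j, hj, rfl⟩ | ⟨j, hj, rfl⟩) | ⟨b, hb, rfl⟩ | ⟨b, hb, rfl⟩
    · refine ⟨(1, j, c j), ⟨(hX _).2 (.inl (.inr ⟨j, hj, rfl⟩)),
        selGraph_adj_center_cand hj (hc j hj).1⟩, ?_⟩
      rintro w ⟨hw, hvw⟩
      obtain ⟨-, -, c', -, rfl⟩ := selGraph_adj_center hvw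
      rcases (hX _).1 hw with (⟨i, -, h⟩ | ⟨i, -, h⟩) | ⟨b, -, h⟩ | ⟨b, -, h⟩ <;>
        simp only [Prod.mk.injEq] at h
      · omega
      · obtain ⟨-, rfl, rfl⟩ := h; rfl
      · omega
      · omega
    · refine ⟨(0, j, 0), ⟨(hX _).2 (.inl (.inl ⟨j, hj, rfl⟩)),
        (selGraph_adj_center_cand hj (hc j hj).1).symm⟩, ?_⟩
      rintro w ⟨hw, hvw⟩
      obtain ⟨-, -, rfl | ⟨b, hb, β, hβ, rfl, hconf⟩⟩ := selGraph_adj_cand hvw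
      · rfl
      · exfalso
        rcases (hX _).1 hw with (⟨i, -, h⟩ | ⟨i, -, h⟩) | ⟨b', -, h⟩ | ⟨b', -, h⟩ <;>
          simp only [Prod.mk.injEq] at h
        · omega
        · omega
        · obtain ⟨h1, rfl⟩ := h
          obtain rfl : β = a b := by omega
          exact (hc j hj).2 b hb hconf
        · omega
    · have hab := ha b
      refine ⟨(4, b), ⟨(hX _).2 (.inr (.inr ⟨b, hb, rfl⟩)),
        selGraph_adj_triangle hb (by omega) (by omega) (by omega) (by omega) (by omega)⟩, ?_⟩
      rintro w ⟨hw, hvw⟩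
      obtain ⟨-, -, h1 | ⟨τ', h1, h2, h3, rfl⟩⟩ := selGraph_adj_bit (by omega) hvw
      · exfalso
        rcases (hX _).1 hw with (⟨i, -, rfl⟩ | ⟨i, hi, rfl⟩) | ⟨b', -, rfl⟩ | ⟨b', -, rfl⟩
        · cases h1
        · obtain ⟨-, -, h | ⟨b', hb', β, hβ, h, hconf⟩⟩ := selGraph_adj_cand hvw.symm
          · simp only [Prod.mk.injEq] at h; omega
          · simp only [Prod.mk.injEq] at h
            obtain ⟨h1, rfl⟩ := h
            obtain rfl : β = a b := by omega
            exact (hc i hi).2 b hb hconf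
        · dsimp only at h1; omega
        · cases h1
      · rcases (hX _).1 hw with (⟨i, -, h⟩ | ⟨i, -, h⟩) | ⟨b', -, h⟩ | ⟨b', -, h⟩ <;>
          simp only [Prod.mk.injEq] at h
        · omega
        · omega
        · obtain ⟨h, rfl⟩ := h; omega
        · rw [h.1]
    · have hab := ha b
      refine ⟨(2 + a b, b), ⟨(hX _).2 (.inr (.inl ⟨b, hb, rfl⟩)),
        selGraph_adj_triangle hb (by omega) (by omega) (by omega) (by omega) (by omega)⟩, ?_⟩
      rintro w ⟨hw, hvw⟩
      obtain ⟨-, -, h1 | ⟨τ', h1, h2, h3, rfl⟩⟩ := selGraph_adj_bit (by omega) hvw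
      · exfalso
        obtain ⟨τ, A, B⟩ := w
        dsimp only at h1
        subst h1
        obtain ⟨-, -, h | ⟨b', hb', β, hβ, h, hconf⟩⟩ := selGraph_adj_cand hvw.symm
        · simp only [Prod.mk.injEq] at h; omega
        · simp only [Prod.mk.injEq] at h; omega
      · rcases (hX _).1 hw with (⟨i, -, h⟩ | ⟨i, -, h⟩) | ⟨b', -, h⟩ | ⟨b', -, h⟩ <;>
          simp only [Prod.mk.injEq] at h
        · omega
        · omega
        · obtain ⟨h, rfl⟩ := h; rw [h]
        · omega

/-- Candidates are independent, so each matching edge has an end in a center or a triangle; no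
center and no triangle is met by two edges, since triangle vertices are adjacent. There are as many
edges as centers and triangles, so each of these is met. All centers being matched, a candidate in
`X` can only be matched to its center, and the edge at a triangle must lie inside it. -/
theorem exists_assignment_of_hasInducedMatching_selGraph
    (h : HasInducedMatching (selGraph Y good Bs conf) (Y + Bs.card)) :
    ∃ a : ℕ × ℕ → ℕ, (∀ b, a b < 2) ∧
      ∀ j < Y, ∃ c, good j c ∧ ∀ b ∈ Bs, ¬ conf j c b.1 b.2 (a b) := by
  classical
  obtain ⟨X, hX, hm⟩ := hasInducedMatching_iff.1 h
  have hm' : ∀ v, ∃ w, v ∈ X → (w ∈ X ∧ (selGraph Y good Bs conf).Adj v w) ∧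
      ∀ y ∈ X, (selGraph Y good Bs conf).Adj v y → y = w := by
    intro v
    by_cases hv : v ∈ X
    · obtain ⟨w, hw, hu⟩ := hm v hv
      exact ⟨w, fun _ => ⟨hw, fun y hy hvy => hu y ⟨hy, hvy⟩⟩⟩
    · exact ⟨v, fun h => absurd h hv⟩
  choose mate hmate using hm'
  have hmem : ∀ {v}, v ∈ X → mate v ∈ X := fun hv => (hmate _ hv).1.1
  have hadj : ∀ {v}, v ∈ X → (selGraph Y good Bs conf).Adj v (mate v) := fun hv => (hmate _ hv).1.2
  have huniq : ∀ {v y}, v ∈ X → y ∈ X → (selGraph Y good Bs conf).Adj v y → y = mate v :=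
    fun hv hy hvy => (hmate _ hv).2 _ hy hvy
  have hinv : ∀ {v}, v ∈ X → mate (mate v) = v := fun hv =>
    (huniq (hmem hv) hv (hadj hv).symm).symm
  -- the endpoint of a matching edge that is not a candidate
  let rep : ℕ × ℕ × ℕ → ℕ × ℕ × ℕ := fun v => if v.1 = 1 then mate v else v
  -- a name for the triangle or the center that contains a vertex
  let cls : ℕ × ℕ × ℕ → ℕ × ℕ × ℕ := fun v => (min v.1 2, v.2)
  have hrep : ∀ {v}, v ∈ X → rep v ∈ X ∧ (rep v).1 ≠ 1 ∧ (v = rep v ∨ v = mate (rep v)) := by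
    intro v hv
    by_cases h1 : v.1 = 1
    · have e : rep v = mate v := if_pos h1
      rw [e, hinv hv]
      refine ⟨hmem hv, ?_, .inr rfl⟩
      obtain ⟨τ, j, c⟩ := v
      dsimp only at h1
      subst h1
      obtain ⟨-, -, h2 | ⟨b, hb, β, hβ, h2, -⟩⟩ := selGraph_adj_cand (hadj hv)
      · simp [h2]
      · rw [h2]
        dsimp only
        omega
    · have e : rep v = v := if_neg h1
      rw [e]
      exact ⟨hv, h1, .inl rfl⟩
  have hcls : ∀ {p q}, p ∈ X → q ∈ X → p.1 ≠ 1 → q.1 ≠ 1 → cls p = cls q → p = q ∨ p = mate q := by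
    rintro ⟨τ, b⟩ ⟨τ', b'⟩ hp hq h1 h1' he
    simp only [cls, Prod.mk.injEq] at he
    dsimp only at h1 h1'
    obtain ⟨he, rfl⟩ := he
    by_cases hτ : τ = τ'
    · exact .inl (by rw [hτ])
    · right
      have h2 : 2 ≤ τ ∧ 2 ≤ τ' := by omega
      obtain ⟨h3, hb, -⟩ := selGraph_adj_bit h2.1 (hadj hp)
      obtain ⟨h4, -, -⟩ := selGraph_adj_bit h2.2 (hadj hq)
      exact huniq hq hp (selGraph_adj_triangle hb h2.2 h4 h2.1 h3 (Ne.symm hτ))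
  let I : Finset (ℕ × ℕ × ℕ) :=
    (Finset.range Y).image (fun j => (0, j, 0)) ∪ Bs.image fun b => (2, b)
  have hI : I.card ≤ Y + Bs.card := by
    refine (Finset.card_union_le _ _).trans (add_le_add ?_ Finset.card_image_le)
    exact Finset.card_image_le.trans (by simp)
  have himage : X.image (fun v => cls (rep v)) ⊆ I := by
    intro i hi
    obtain ⟨v, hv, rfl⟩ := Finset.mem_image.1 hi
    obtain ⟨hr, hr1, -⟩ := hrep hv
    generalize rep v = r at hr hr1
    obtain ⟨τ, j, b⟩ := r
    dsimp only at hr1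
    rcases Nat.eq_zero_or_pos τ with rfl | hτ
    · obtain ⟨rfl, hj, -⟩ := selGraph_adj_center (hadj hr)
      exact Finset.mem_union_left _ (Finset.mem_image.2 ⟨j, Finset.mem_range.2 hj, rfl⟩)
    · have h2 : 2 ≤ τ := by omega
      obtain ⟨-, hb, -⟩ := selGraph_adj_bit h2 (hadj hr)
      refine Finset.mem_union_right _ (Finset.mem_image.2 ⟨_, hb, ?_⟩)
      simp [cls, h2]
  -- The vertices whose edge is assigned to a given center or triangle are the two ends of a single
  -- edge.
  have hfib : X.card ≤ 2 * (X.image (fun v => cls (rep v))).card := by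
    refine Finset.card_le_mul_card_image X 2 fun i hi => ?_
    obtain ⟨v, hv, rfl⟩ := Finset.mem_image.1 hi
    obtain ⟨hr, hr1, -⟩ := hrep hv
    refine (Finset.card_le_card (t := {rep v, mate (rep v)}) fun x hx => ?_).trans
      Finset.card_le_two
    obtain ⟨hx, hxv⟩ := Finset.mem_filter.1 hx
    obtain ⟨hx1, hx2, hx3⟩ := hrep hx
    rw [Finset.mem_insert, Finset.mem_singleton]
    rcases hcls hx1 hr hx2 hr1 hxv with h | h
    · rwa [h] at hx3
    · rw [h, hinv hr] at hx3
      exact hx3.symm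
  -- `X` has `2 * (Y + Bs.card)` elements and fibers of size at most 2, so its image has at least `Y
  -- + Bs.card` elements, while `I` has at most that many.
  have hIeq : X.image (fun v => cls (rep v)) = I :=
    Finset.eq_of_subset_of_card_le himage (by omega)
  have hcenter : ∀ j < Y, (0, j, 0) ∈ X := by
    intro j hj
    have : (0, j, 0) ∈ I :=
      Finset.mem_union_left _ (Finset.mem_image.2 ⟨j, Finset.mem_range.2 hj, rfl⟩)
    rw [← hIeq] at this
    obtain ⟨v, hv, he⟩ := Finset.mem_image.1 this
    obtain ⟨hr, hr1, -⟩ := hrep hv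
    obtain ⟨h1, h2⟩ := Prod.mk.inj he
    have h3 : (rep v).1 = 0 := by omega
    rw [← Prod.mk.eta (p := rep v), h3, h2] at hr
    exact hr
  have hcand : ∀ j c, (1, j, c) ∈ X → mate (1, j, c) = (0, j, 0) := by
    intro j c hX
    obtain ⟨hj, hg, -⟩ := selGraph_adj_cand (hadj hX)
    exact (huniq hX (hcenter j hj) (selGraph_adj_center_cand hj hg).symm).symm
  -- The edge at the triangle cannot lead to a candidate, whose mate is a center. So it joins two of
  -- the vertices 2, 3, 4, and one of these is a value vertex 2 or 3.
  have hbit : ∀ b ∈ Bs, (3, b) ∈ X ∨ (2, b) ∈ X := by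
    intro b hb
    have : (2, b) ∈ I := Finset.mem_union_right _ (Finset.mem_image.2 ⟨b, hb, rfl⟩)
    rw [← hIeq] at this
    obtain ⟨v, hv, he⟩ := Finset.mem_image.1 this
    obtain ⟨hr, hr1, -⟩ := hrep hv
    generalize rep v = r at hr hr1 he
    obtain ⟨τ, b'⟩ := r
    obtain ⟨h1, h2⟩ := Prod.mk.inj he
    dsimp only at h1 h2 hr1
    subst h2
    have hτ : 2 ≤ τ := by omega
    obtain ⟨h4, -, h5 | ⟨τ', h5, h6, h7, h8⟩⟩ := selGraph_adj_bit hτ (hadj hr)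
    · exfalso
      have h9 := hinv hr
      have h10 := hmem hr
      generalize mate (τ, b') = w at h5 h9 h10
      obtain ⟨τ', j, c⟩ := w
      dsimp only at h5
      subst h5
      rw [hcand j c h10] at h9
      have := congrArg Prod.fst h9
      dsimp only at this
      omega
    · have h9 := hmem hr
      rw [h8] at h9
      rcases (by omega : τ = 3 ∨ τ' = 3 ∨ τ = 2 ∨ τ' = 2) with rfl | rfl | rfl | rfl
      · exact .inl hr
      · exact .inl h9
      · exact .inr hr
      · exact .inr h9
  refine ⟨fun b => if (3, b) ∈ X then 1 else 0, fun b => by dsimp only; split_ifs <;> omega,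
    fun j hj => ?_⟩
  obtain ⟨-, -, c, hc, hmc⟩ := selGraph_adj_center (hadj (hcenter j hj))
  have hcX := hmem (hcenter j hj)
  rw [hmc] at hcX
  refine ⟨c, hc, fun b hb hconf => ?_⟩
  have key : ∀ β < 2, (2 + β, b) ∈ X → ¬ conf j c b.1 b.2 β := by
    intro β hβ hX hconf
    have h1 := huniq hcX hX (selGraph_adj_cand_bit hj hc hb hβ hconf)
    rw [hcand j c hcX] at h1
    have := congrArg Prod.fst h1
    dsimp only at this
    omega
  dsimp only at hconf
  split_ifs at hconf with h3
  · exact key 1 (by omega) h3 hconf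
  · exact key 0 (by omega) ((hbit b hb).resolve_left h3) hconf

theorem selGraph_isVertexCover :
    (selGraph Y good Bs conf).IsVertexCover
      (((Finset.range Y).image (fun j => (0, j, 0)) ∪
        (({2, 3, 4} : Finset ℕ) ×ˢ Bs) : Finset (ℕ × ℕ × ℕ)) : Set (ℕ × ℕ × ℕ)) := by
  have key : ∀ u v, SelArc Y good Bs conf u v → u ∈ ((Finset.range Y).image (fun j => (0, j, 0)) ∪
        (({2, 3, 4} : Finset ℕ) ×ˢ Bs) : Finset (ℕ × ℕ × ℕ)) ∨
      v ∈ ((Finset.range Y).image (fun j => (0, j, 0)) ∪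
        (({2, 3, 4} : Finset ℕ) ×ˢ Bs) : Finset (ℕ × ℕ × ℕ)) := by
    rintro ⟨τ, A, B⟩ ⟨τ', b'⟩ h
    simp only [Finset.mem_union, Finset.mem_image, Finset.mem_range, Finset.mem_product,
      Finset.mem_insert, Finset.mem_singleton]
    rcases h with ⟨h1, -, -, h2, h3, -⟩ | ⟨-, -, -, h1, h2, -⟩ | ⟨h1, h2, h3, h4, h5⟩
    · dsimp only at h1 h2 h3
      subst h1 h2
      exact .inl (.inl ⟨A, h3, rfl⟩)
    · dsimp only at h1 h2
      exact .inr (.inr ⟨by omega, h1⟩)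
    · dsimp only at h1 h2 h3 h5
      exact .inl (.inr ⟨by omega, h5⟩)
  rintro u v (h | h)
  · exact key u v h
  · exact (key v u h).symm

/-- The cover consists of the centers and the triangles. The number of candidates, which is not
bounded in terms of the parameter, does not enter. -/
theorem vertexCoverNum_comap_selGraph_le {V : Type} {φ : V → ℕ × ℕ × ℕ}
    (hφ : Function.Injective φ) :
    ((selGraph Y good Bs conf).comap φ).vertexCoverNum.toNat ≤ Y + 3 * Bs.card := by
  set C : Finset (ℕ × ℕ × ℕ) :=
    (Finset.range Y).image (fun j => (0, j, 0)) ∪ (({2, 3, 4} : Finset ℕ) ×ˢ Bs) with hC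
  have h1 : ((selGraph Y good Bs conf).comap φ).IsVertexCover (φ ⁻¹' (C : Set (ℕ × ℕ × ℕ))) :=
    fun u v h => selGraph_isVertexCover (v := φ u) (w := φ v) h
  have h2 : (φ ⁻¹' (C : Set (ℕ × ℕ × ℕ))).encard ≤ (C.card : ℕ∞) := by
    rw [← hφ.encard_image, ← Set.encard_coe_eq_coe_finsetCard]
    exact Set.encard_le_encard (Set.image_preimage_subset _ _)
  have h3 : C.card ≤ Y + 3 * Bs.card := by
    refine (Finset.card_union_le _ _).trans (add_le_add ?_ ?_)
    · exact Finset.card_image_le.trans (by simp)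
    · simp [Finset.card_product]
  exact (ENat.toNat_le_of_le_natCast (h1.vertexCoverNum_le.trans h2)).trans h3

end Selection

end ParamComplexity

/-! ## Satisfying assignments of weight `k` as local selections -/

namespace ParamComplexity

/-- The digit of `c` at the position `p` in base `M`. -/
def digit (M p c : ℕ) : ℕ := c / M ^ p % M

theorem exists_digits {M : ℕ} (f : ℕ → ℕ) (m : ℕ) (hf : ∀ i < m, f i < M) :
    ∃ c < M ^ m, ∀ i < m, digit M i c = f i := by
  induction m generalizing f with
  | zero => exact ⟨0, by simp, by simp⟩
  | succ m ih =>
    obtain ⟨c, hc, h⟩ := ih (fun i => f (i + 1)) fun i hi => hf _ (by omega)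
    have h0 := hf 0 (by omega)
    refine ⟨f 0 + M * c, ?_, fun i hi => ?_⟩
    · calc f 0 + M * c < M + M * c := by omega
        _ = M * (c + 1) := by ring
        _ ≤ M * M ^ m := Nat.mul_le_mul_left _ hc
        _ = M ^ (m + 1) := by ring
    · cases i with
      | zero => simp [digit, Nat.mod_eq_of_lt h0]
      | succ i =>
        rw [← h i (by omega), digit, digit, pow_succ', ← Nat.div_div_eq_div_mul,
          Nat.add_mul_div_left _ _ (by omega), Nat.div_eq_of_lt h0, zero_add]

theorem digit_lt {M : ℕ} (hM : 0 < M) (p c : ℕ) : digit M p c < M := Nat.mod_lt _ hM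

/-- Bits at powers of two from `M` on vanish for numbers below `M`. A bit is indexed by the power
`P` itself rather than by its exponent, so that it is read by one division. -/
theorem eq_of_bits_eq {M x y : ℕ} (hx : x < M) (hy : y < M)
    (h : ∀ P < M, (∃ i, P = 2 ^ i) → x / P % 2 = y / P % 2) : x = y := by
  refine Nat.eq_of_testBit_eq fun i => ?_
  rw [Nat.testBit_eq_decide_div_mod_eq, Nat.testBit_eq_decide_div_mod_eq]
  by_cases hi : 2 ^ i < M
  · rw [h _ hi ⟨i, rfl⟩]
  · rw [Nat.div_eq_of_lt (by omega), Nat.div_eq_of_lt (by omega)]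

/-- The literal with variable `v` and sign `b` is false if the true variables, increased by one,
include `l` and none strictly between `l` and `r`, and this is visible from `l` and `r`. -/
def LitFalse (l r v : ℕ) (b : Bool) : Prop :=
  if b then l < v + 1 ∧ v + 1 < r else l = v + 1

/-- The `i`-th literal of the clause is false according to `l (p + i)` and `r (p + i)`. -/
def ClauseFalse {n : ℕ} (l r : ℕ → ℕ) (p : ℕ) (cl : Clause n) : Prop :=
  ∀ (i : ℕ) (h : i < cl.length), LitFalse (l (p + i)) (r (p + i)) cl[i].1 cl[i].2

theorem clauseFalse_nil {n : ℕ} (l r : ℕ → ℕ) (p : ℕ) : ClauseFalse l r p ([] : Clause n) := by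
  intro i h
  simp at h

theorem clauseFalse_cons {n : ℕ} (l r : ℕ → ℕ) (p : ℕ) (x : Literal n) (c : Clause n) :
    ClauseFalse l r p (x :: c) ↔ LitFalse (l p) (r p) x.1 x.2 ∧ ClauseFalse l r (p + 1) c := by
  constructor
  · intro h
    refine ⟨h 0 (by simp), fun i hi => ?_⟩
    have := h (i + 1) (by simpa using hi)
    rw [show p + (i + 1) = p + 1 + i by omega] at this
    exact this
  · rintro ⟨h1, h2⟩ i hi
    cases i with
    | zero => exact h1
    | succ i =>
      have := h2 i (by simpa using hi)
      rw [show p + 1 + i = p + (i + 1) by omega] at this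
      exact this

/-! ### Weight-`k` assignments as increasing sequences, and their gaps. -/

section Enumeration

variable {n k : ℕ}

/-- The sequence `y 1 < ⋯ < y k` consists of numbers strictly between `y 0 = 0` and
`y (k + 1) = n + 1`. -/
structure IsSelection (n k : ℕ) (y : ℕ → ℕ) : Prop where
  zero : y 0 = 0
  last : y (k + 1) = n + 1
  lt_succ : ∀ s ≤ k, y s < y (s + 1)

/-- The assignment that makes the variables in a sequence true. -/
def selAssignment (n k : ℕ) (y : ℕ → ℕ) (v : Fin n) : Bool :=
  decide (∃ s < k, y (s + 1) = v + 1)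

theorem IsSelection.lt {y : ℕ → ℕ} (h : IsSelection n k y) {s t : ℕ} (hst : s < t)
    (ht : t ≤ k + 1) : y s < y t := by
  induction t with
  | zero => omega
  | succ t ih =>
    have h1 := h.lt_succ t (by omega)
    rcases Nat.lt_succ_iff_lt_or_eq.1 hst with h2 | rfl
    · exact (ih h2 (by omega)).trans h1
    · exact h1

theorem IsSelection.le_apply {y : ℕ → ℕ} (h : IsSelection n k y) {s : ℕ} (hs : s ≤ k + 1) :
    s ≤ y s := by
  induction s with
  | zero => omega
  | succ s ih =>
    have := ih (by omega)
    have := h.lt_succ s (by omega)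
    omega

theorem IsSelection.le {y : ℕ → ℕ} (h : IsSelection n k y) : k ≤ n := by
  have := h.le_apply le_rfl
  rw [h.last] at this
  omega

theorem IsSelection.weight {y : ℕ → ℕ} (h : IsSelection n k y) :
    weight (selAssignment n k y) = k := by
  have hy : ∀ s < k, 0 < y (s + 1) ∧ y (s + 1) < n + 1 := fun s hs =>
    ⟨by have := h.le_apply (s := s + 1) (by omega); omega,
      by rw [← h.last]; exact h.lt (by omega) le_rfl⟩
  rw [ParamComplexity.weight]
  conv_rhs => rw [← Finset.card_range k]
  symm
  refine Finset.card_bij (fun s hs => ⟨y (s + 1) - 1, ?_⟩) ?_ ?_ ?_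
  · have := hy s (Finset.mem_range.1 hs)
    omega
  · intro s hs
    have := hy s (Finset.mem_range.1 hs)
    simp only [Finset.mem_filter, Finset.mem_univ, true_and, selAssignment, decide_eq_true_eq]
    exact ⟨s, Finset.mem_range.1 hs, by omega⟩
  · intro s hs t ht he
    have h1 := hy s (Finset.mem_range.1 hs)
    have h2 := hy t (Finset.mem_range.1 ht)
    have h3 : y (s + 1) - 1 = y (t + 1) - 1 := congrArg Fin.val he
    rw [Finset.mem_range] at hs ht
    by_contra hne
    rcases lt_or_gt_of_ne hne with hlt | hlt
    · have := h.lt (s := s + 1) (t := t + 1) (by omega) (by omega)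
      omega
    · have := h.lt (s := t + 1) (t := s + 1) (by omega) (by omega)
      omega
  · intro v hv
    simp only [Finset.mem_filter, Finset.mem_univ, true_and, selAssignment,
      decide_eq_true_eq] at hv
    obtain ⟨s, hs, he⟩ := hv
    exact ⟨s, Finset.mem_range.2 hs, Fin.ext (by dsimp only; omega)⟩

theorem exists_isSelection (a : Fin n → Bool) :
    ∃ y, IsSelection n (weight a) y ∧ a = selAssignment n (weight a) y := by
  generalize hk : weight a = k
  let S : Finset (Fin n) := Finset.univ.filter fun v => a v = true
  let e := S.orderIsoOfFin hk
  have hS : ∀ i, a (e i) = true := fun i => (Finset.mem_filter.1 (e i).2).2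
  -- The true variables in increasing order; the shift by one frees 0 for the left sentinel, and `n
  -- + 1` is the right one.
  let y : ℕ → ℕ := fun s => if s = 0 then 0 else
    if h : s - 1 < k then (e ⟨s - 1, h⟩ : Fin n) + 1 else n + 1
  have hy : ∀ s (hs : s < k), y (s + 1) = (e ⟨s, hs⟩ : Fin n) + 1 := by
    intro s hs
    simp [y, hs]
  have hlast : y (k + 1) = n + 1 := by simp [y]
  refine ⟨y, ⟨rfl, hlast, fun s hs => ?_⟩, funext fun v => ?_⟩
  · cases s with
    | zero =>
      have h0 : y 0 = 0 := rfl
      rw [h0]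
      rcases Nat.eq_zero_or_pos k with rfl | hk
      · rw [hlast]; omega
      · rw [hy 0 hk]; omega
    | succ s =>
      rw [hy s (by omega)]
      rcases Nat.lt_or_ge (s + 1) k with h | h
      · rw [hy _ h]
        have : e ⟨s, by omega⟩ < e ⟨s + 1, h⟩ := e.lt_iff_lt.2 (by simp [Fin.lt_def])
        have : ((e ⟨s, by omega⟩ : Fin n) : ℕ) < (e ⟨s + 1, h⟩ : Fin n) := this
        omega
      · rw [show s + 1 = k by omega, hlast]
        have := (e ⟨s, by omega⟩ : Fin n).2
        omega
  · rw [Bool.eq_iff_iff, selAssignment, decide_eq_true_eq]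
    constructor
    · intro hv
      have hvS : v ∈ S := Finset.mem_filter.2 ⟨Finset.mem_univ _, hv⟩
      refine ⟨e.symm ⟨v, hvS⟩, (e.symm ⟨v, hvS⟩).2, ?_⟩
      rw [hy _ (e.symm ⟨v, hvS⟩).2]
      simp
    · rintro ⟨s, hs, h⟩
      rw [hy s hs] at h
      have : (e ⟨s, hs⟩ : Fin n) = v := Fin.ext (by omega)
      rw [← this]
      exact hS _

/-- The number `v + 1` is either an element `y (s + 1)` with `s < k` or strictly inside a gap. Both
cases are visible from the two ends of one gap; the left sentinel 0 is no `v + 1` and causes no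
false alarm. -/
theorem IsSelection.exists_litFalse_iff {y : ℕ → ℕ} (h : IsSelection n k y) (x : Literal n) :
    (∃ g ≤ k, LitFalse (y g) (y (g + 1)) x.1 x.2) ↔ selAssignment n k y x.1 ≠ x.2 := by
  obtain ⟨v, b⟩ := x
  dsimp only
  have hv := v.2
  cases b with
  | false =>
    simp only [LitFalse, Bool.false_eq_true, if_false, selAssignment, ne_eq, Bool.not_eq_false,
      decide_eq_true_eq]
    constructor
    · rintro ⟨g, hg, he⟩
      cases g with
      | zero => rw [h.zero] at he; omega
      | succ g => exact ⟨g, hg, he⟩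
    · rintro ⟨s, hs, he⟩
      exact ⟨s + 1, hs, he⟩
  | true =>
    simp only [LitFalse, if_true, selAssignment, ne_eq, Bool.not_eq_true, decide_eq_false_iff_not]
    constructor
    · rintro ⟨g, hg, h1, h2⟩ ⟨s, hs, he⟩
      rcases lt_or_ge g (s + 1) with hlt | hge
      · rcases Nat.lt_or_ge (g + 1) (s + 1) with h3 | h3
        · have := h.lt h3 (by omega)
          omega
        · rw [show g + 1 = s + 1 by omega] at h2
          omega
      · rcases Nat.lt_or_ge (s + 1) g with h3 | h3
        · have := h.lt h3 (by omega)
          omega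
        · rw [show g = s + 1 by omega] at h1
          omega
    · intro hne
      -- The first gap whose right end exceeds `v + 1` contains it: minimality and `hne` put the
      -- left end below.
      have hex : ∃ g, v + 1 < y (g + 1) := ⟨k, by rw [h.last]; omega⟩
      classical
      have h1 := Nat.find_spec hex
      have h2 : Nat.find hex ≤ k := Nat.find_min' hex (by rw [h.last]; omega)
      refine ⟨Nat.find hex, h2, ?_, h1⟩
      cases hg : Nat.find hex with
      | zero => rw [h.zero]; omega
      | succ g =>
        have h3 := Nat.find_min hex (m := g) (by omega)
        have h4 : y (g + 1) ≠ v + 1 := fun he => hne ⟨g, by omega, he⟩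
        omega

/-- A clause is false if each of its literals has its own gap as witness; `g` collects these gap
numbers by position in the clause. -/
theorem IsSelection.sat_iff {y : ℕ → ℕ} (h : IsSelection n k y) (φ : CNF n) :
    φ.Sat (selAssignment n k y) ↔ ∀ g : ℕ → ℕ, (∀ p, g p ≤ k) →
      ∀ c ∈ φ, ¬ ClauseFalse (fun p => y (g p)) (fun p => y (g p + 1)) 0 c := by
  constructor
  · intro hs g hg cl hc hf
    obtain ⟨x, hx, he⟩ := hs cl hc
    obtain ⟨i, hi, rfl⟩ := List.getElem_of_mem hx
    exact (h.exists_litFalse_iff cl[i]).1 ⟨g (0 + i), hg _, hf i hi⟩ he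
  · intro hg cl hc
    by_contra hne
    push Not at hne
    have : ∀ i, ∃ g ≤ k, ∀ hi : i < cl.length, LitFalse (y g) (y (g + 1)) cl[i].1 cl[i].2 := by
      intro i
      by_cases hi : i < cl.length
      · obtain ⟨g, hg, hl⟩ := (h.exists_litFalse_iff cl[i]).2 (hne _ (List.getElem_mem hi))
        exact ⟨g, hg, fun _ => hl⟩
      · exact ⟨0, by omega, fun h => absurd h hi⟩
    choose g hg1 hg2 using this
    refine hg g hg1 cl hc fun i hi => ?_
    simpa only [zero_add] using hg2 i hi

end Enumeration

/-! ### Candidates for tuples of gaps, and their agreement through bits. -/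

section Local

variable {n : ℕ} (k D : ℕ) (φ : CNF n)

/-- The candidate `c` for the block `j` gives, for each `p < D`, two consecutive elements of a
selection that are in the gap number `digit (k + 1) p j`, and these show no clause to be false. -/
def GoodCandidate (j c : ℕ) : Prop :=
  c < (n + 2) ^ (2 * D) ∧
  (∀ p < D, digit (n + 2) (2 * p) c < digit (n + 2) (2 * p + 1) c ∧
    (digit (k + 1) p j = 0 → digit (n + 2) (2 * p) c = 0) ∧
    (digit (k + 1) p j = k → digit (n + 2) (2 * p + 1) c = n + 1)) ∧
  ∀ cl ∈ φ, ¬ ClauseFalse (fun p => digit (n + 2) (2 * p) c)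
    (fun p => digit (n + 2) (2 * p + 1) c) 0 cl

/-- The candidate `c` for the block `j` contradicts the value `β` of the bit at `P` of the element
`s + 1` of a selection. -/
def Conflict (n k D j c s P β : ℕ) : Prop :=
  ∃ p < D, (digit (k + 1) p j = s + 1 ∧ digit (n + 2) (2 * p) c / P % 2 ≠ β) ∨
    (digit (k + 1) p j = s ∧ digit (n + 2) (2 * p + 1) c / P % 2 ≠ β)

open Classical in
/-- The bits of a selection of `k` of the numbers `1, …, n`. -/
noncomputable def selBits (n k : ℕ) : Finset (ℕ × ℕ) :=
  Finset.range k ×ˢ (Finset.range (n + 2)).filter fun P => ∃ i, P = 2 ^ i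

theorem mem_selBits {k : ℕ} {b : ℕ × ℕ} :
    b ∈ selBits n k ↔ b.1 < k ∧ b.2 < n + 2 ∧ ∃ i, b.2 = 2 ^ i := by
  simp [selBits]

variable {k D φ}

theorem exists_assignment_of_isSelection (hφ : ∀ c ∈ φ, c.length ≤ D) {y : ℕ → ℕ}
    (h : IsSelection n k y) (hs : φ.Sat (selAssignment n k y)) :
    ∃ a : ℕ × ℕ → ℕ, (∀ b, a b < 2) ∧ ∃ c : ℕ → ℕ, ∀ j < (k + 1) ^ D,
      GoodCandidate k D φ j (c j) ∧
        ∀ b ∈ selBits n k, ¬ Conflict n k D j (c j) b.1 b.2 (a b) := by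
  refine ⟨fun b => y (b.1 + 1) / b.2 % 2, fun b => Nat.mod_lt _ (by omega), ?_⟩
  have hg : ∀ j p, digit (k + 1) p j ≤ k := fun j p => by
    have := digit_lt (M := k + 1) (by omega) p j
    omega
  have hy : ∀ s ≤ k + 1, y s < n + 2 := by
    intro s hs
    rcases hs.lt_or_eq with h1 | rfl
    · have := h.lt h1 le_rfl
      rw [h.last] at this
      omega
    · rw [h.last]; omega
  have hc : ∀ j, ∃ c < (n + 2) ^ (2 * D), ∀ p < D,
      digit (n + 2) (2 * p) c = y (digit (k + 1) p j) ∧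
      digit (n + 2) (2 * p + 1) c = y (digit (k + 1) p j + 1) := by
    intro j
    -- The digits `2 * p` and `2 * p + 1` are the left and right end of the `p`-th gap: the parity
    -- of the digit's position is added to the gap number.
    obtain ⟨c, hc, hd⟩ := exists_digits (M := n + 2)
      (fun i => y (digit (k + 1) (i / 2) j + i % 2)) (2 * D) (fun i _ => hy _ (by
        have := hg j (i / 2)
        omega))
    refine ⟨c, hc, fun p hp => ⟨?_, ?_⟩⟩
    · rw [hd _ (by omega)]
      simp
    · rw [hd _ (by omega), show (2 * p + 1) / 2 = p by omega, show (2 * p + 1) % 2 = 1 by omega]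
  choose c hc1 hc2 using hc
  refine ⟨c, fun j _ => ⟨⟨hc1 j, fun p hp => ?_, ?_⟩, ?_⟩⟩
  · rw [(hc2 j p hp).1, (hc2 j p hp).2]
    refine ⟨h.lt_succ _ (hg j p), fun h0 => by rw [h0, h.zero], fun h0 => by rw [h0, h.last]⟩
  · intro cl hcl hf
    refine (h.sat_iff φ).1 hs (fun p => digit (k + 1) p j) (hg j) cl hcl fun i hi => ?_
    have hiD : 0 + i < D := by have := hφ cl hcl; omega
    have := hf i hi
    dsimp only at this ⊢
    rwa [(hc2 j _ hiD).1, (hc2 j _ hiD).2] at this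
  · rintro ⟨s, P⟩ hb ⟨p, hp, ⟨h1, h2⟩ | ⟨h1, h2⟩⟩
    · rw [(hc2 j p hp).1, h1] at h2
      exact h2 rfl
    · rw [(hc2 j p hp).2, h1] at h2
      exact h2 rfl

/-- The bit values need not come from a sequence in advance, so `y` is read from candidates. Two
candidates that both show the element `s + 1` agree with the same bits and hence with each other;
the sentinels carry no bits and are fixed by `GoodCandidate`. Thus all candidates show ends of gaps
of one `y`, and what they satisfy locally, strict increase and absence of false clauses, holds for
`y`. -/
theorem exists_isSelection_of_assignment (hD : 0 < D) (hφ : ∀ c ∈ φ, c.length ≤ D)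
    {a : ℕ × ℕ → ℕ} (ha : ∀ j < (k + 1) ^ D, ∃ c, GoodCandidate k D φ j c ∧
      ∀ b ∈ selBits n k, ¬ Conflict n k D j c b.1 b.2 (a b)) :
    ∃ y, IsSelection n k y ∧ φ.Sat (selAssignment n k y) := by
  have hg : ∀ j p, digit (k + 1) p j ≤ k := fun j p => by
    have := digit_lt (M := k + 1) (by omega) p j
    omega
  choose! c hgood hconf using ha
  have hJ : ∀ g : ℕ → ℕ, ∃ j, (∀ p, g p ≤ k) → j < (k + 1) ^ D ∧
      ∀ p < D, digit (k + 1) p j = g p := by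
    intro g
    by_cases h : ∀ p, g p ≤ k
    · obtain ⟨j, hj, hd⟩ := exists_digits (M := k + 1) g D fun p _ => Nat.lt_succ_of_le (h p)
      exact ⟨j, fun _ => ⟨hj, hd⟩⟩
    · exact ⟨0, fun h' => absurd h' h⟩
  choose J hJ using hJ
  have hJ0 : ∀ s ≤ k, J (fun _ => s) < (k + 1) ^ D ∧ digit (k + 1) 0 (J fun _ => s) = s :=
    fun s hs => ⟨(hJ _ fun _ => hs).1, (hJ _ fun _ => hs).2 0 hD⟩
  -- The block `J (fun _ => s)` belongs to the constant tuple `(s, …, s)`; its position 0, available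
  -- since `0 < D`, shows the left end of gap `s`.
  let y : ℕ → ℕ := fun s => if s ≤ k then digit (n + 2) 0 (c (J fun _ => s)) else n + 1
  have hy : ∀ s ≤ k, y s = digit (n + 2) (2 * 0) (c (J fun _ => s)) := fun s hs => if_pos hs
  have hlast : y (k + 1) = n + 1 := if_neg (by omega)
  have hzero : y 0 = 0 := by
    obtain ⟨h1, h2⟩ := hJ0 0 (by omega)
    rw [hy 0 (by omega)]
    exact ((hgood _ h1).2.1 0 hD).2.1 h2
  have hbit : ∀ s < k, ∀ P < n + 2, (∃ i, P = 2 ^ i) → y (s + 1) / P % 2 = a (s, P) := by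
    intro s hs P hP hi
    obtain ⟨h1, h2⟩ := hJ0 (s + 1) hs
    rw [hy _ hs]
    by_contra hne
    exact hconf _ h1 (s, P) (mem_selBits.2 ⟨hs, hP, hi⟩) ⟨0, hD, .inl ⟨h2, hne⟩⟩
  have hylt : ∀ s, y s < n + 2 := by
    intro s
    by_cases hs : s ≤ k
    · rw [hy s hs]; exact digit_lt (by omega) _ _
    · have : y s = n + 1 := if_neg hs
      omega
  have hlo : ∀ j < (k + 1) ^ D, ∀ p < D, digit (n + 2) (2 * p) (c j) = y (digit (k + 1) p j) := by
    intro j hj p hp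
    cases hs : digit (k + 1) p j with
    | zero => rw [hzero, ((hgood j hj).2.1 p hp).2.1 hs]
    | succ s =>
      have hsk : s < k := by have := hg j p; omega
      refine eq_of_bits_eq (digit_lt (by omega) _ _) (hylt _) fun P hP hi => ?_
      rw [hbit s hsk P hP hi]
      by_contra hne
      exact hconf j hj (s, P) (mem_selBits.2 ⟨hsk, hP, hi⟩) ⟨p, hp, .inl ⟨hs, hne⟩⟩
  have hhi : ∀ j < (k + 1) ^ D, ∀ p < D,
      digit (n + 2) (2 * p + 1) (c j) = y (digit (k + 1) p j + 1) := by
    intro j hj p hp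
    rcases (hg j p).lt_or_eq with hsk | hsk
    · refine eq_of_bits_eq (digit_lt (by omega) _ _) (hylt _) fun P hP hi => ?_
      rw [hbit _ hsk P hP hi]
      by_contra hne
      exact hconf j hj (_, P) (mem_selBits.2 ⟨hsk, hP, hi⟩) ⟨p, hp, .inr ⟨rfl, hne⟩⟩
    · rw [((hgood j hj).2.1 p hp).2.2 hsk, hsk, hlast]
  have hsel : IsSelection n k y := by
    refine ⟨hzero, hlast, fun s hs => ?_⟩
    obtain ⟨h1, h2⟩ := hJ0 s hs
    have h3 := ((hgood _ h1).2.1 0 hD).1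
    rwa [hlo _ h1 0 hD, hhi _ h1 0 hD, h2] at h3
  refine ⟨y, hsel, (hsel.sat_iff φ).2 fun g hgk cl hcl hf => ?_⟩
  obtain ⟨h1, h2⟩ := hJ g hgk
  refine (hgood _ h1).2.2 cl hcl fun i hi => ?_
  have hiD : 0 + i < D := by have := hφ cl hcl; omega
  have := hf i hi
  dsimp only at this ⊢
  rwa [← h2 _ hiD, ← hlo _ h1 _ hiD, ← hhi _ h1 _ hiD] at this

end Local

end ParamComplexity

/-! ## Reading formulas from words -/

namespace ParamComplexity

open RegisterProgram

/-- The number of symbols `one` at the beginning of a word. -/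
def ones : List CNFSym → ℕ
  | CNFSym.one :: u => ones u + 1
  | _ => 0

theorem ones_replicate_append {s : CNFSym} (hs : s ≠ CNFSym.one) (m : ℕ) (u : List CNFSym) :
    ones (List.replicate m CNFSym.one ++ s :: u) = m := by
  induction m with
  | zero => cases s <;> first | rfl | exact absurd rfl hs
  | succ m ih => rw [List.replicate_succ, List.cons_append, ones, ih]

theorem ones_le_length : ∀ u : List CNFSym, ones u ≤ u.length
  | [] => le_rfl
  | CNFSym.one :: u => Nat.succ_le_succ (ones_le_length u)
  | CNFSym.pos :: _ | CNFSym.neg :: _ | CNFSym.sep :: _ => Nat.zero_le _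

/-- This bounded quantifier makes `ones` computable, as the number of `i` that satisfy it. -/
theorem lt_ones_iff : ∀ {u : List CNFSym} {i : ℕ},
    i < ones u ↔ ∀ j < i + 1, u[j]? = some CNFSym.one
  | [], i => by
      simp only [ones, Nat.not_lt_zero, false_iff]
      intro h
      simpa using h 0 (by omega)
  | CNFSym.one :: u, 0 => by
      simp [ones]
  | CNFSym.one :: u, i + 1 => by
      rw [ones, Nat.succ_lt_succ_iff, lt_ones_iff (u := u), Nat.forall_lt_succ_left (n := i + 1)]
      simp
  | CNFSym.pos :: u, i | CNFSym.neg :: u, i | CNFSym.sep :: u, i => by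
      simp only [ones, Nat.not_lt_zero, false_iff]
      intro h
      simpa using h 0 (by omega)

/-- The word begins with a clause with at most `m` literals all of which are false according to
`l` and `r`. -/
def WordFalse (l r : ℕ → ℕ) : ℕ → ℕ → List CNFSym → Prop
  | 0, _, u => u[0]? = some CNFSym.sep
  | m + 1, p, u => u[0]? = some CNFSym.sep ∨
      (u[ones u]? = some CNFSym.pos ∧ LitFalse (l p) (r p) (ones u) true ∨
        u[ones u]? = some CNFSym.neg ∧ LitFalse (l p) (r p) (ones u) false) ∧
      WordFalse l r m (p + 1) (u.drop (ones u + 1))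

/-- The leading ones give the variable and the symbol after them the sign. The recursion depth `m`
is a constant, so `WordFalse` unfolds to a fixed combination of tests on the input tape. -/
theorem wordFalse_encClause_append {n : ℕ} (l r : ℕ → ℕ) (w : List CNFSym) :
    ∀ {m : ℕ} (p : ℕ) (cl : Clause n), cl.length ≤ m →
      (WordFalse l r m p (encClause cl ++ w) ↔ ClauseFalse l r p cl)
  | 0, p, [], _ => by simp [WordFalse, encClause, clauseFalse_nil]
  | m + 1, p, [], _ => by simp [WordFalse, encClause, clauseFalse_nil]
  | m + 1, p, (v, b) :: cl, h => by
      have ih := wordFalse_encClause_append l r w (p + 1) cl (Nat.le_of_succ_le_succ h)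
      have hs : (if b then CNFSym.pos else CNFSym.neg) ≠ CNFSym.one := by cases b <;> decide
      have he : encClause ((v, b) :: cl) ++ w = List.replicate v CNFSym.one ++
          (if b then CNFSym.pos else CNFSym.neg) :: (encClause cl ++ w) := by
        simp [encClause, encLiteral]
      have h0 : (List.replicate (v : ℕ) CNFSym.one ++
          (if b then CNFSym.pos else CNFSym.neg) :: (encClause cl ++ w))[0]? ≠ some CNFSym.sep := by
        cases hv : (v : ℕ) with
        | zero => cases b <;> simp
        | succ i => simp [List.replicate_succ]
      have h1 : (List.replicate (v : ℕ) CNFSym.one ++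
          (if b then CNFSym.pos else CNFSym.neg) :: (encClause cl ++ w))[(v : ℕ)]? =
            some (if b then CNFSym.pos else CNFSym.neg) := by
        rw [List.getElem?_append_right (by simp)]
        simp
      have h2 : (List.replicate (v : ℕ) CNFSym.one ++
          (if b then CNFSym.pos else CNFSym.neg) :: (encClause cl ++ w)).drop (v + 1) =
            encClause cl ++ w := by
        rw [List.drop_append]
        simp
      rw [he, WordFalse, ones_replicate_append hs, h1, h2, ih, clauseFalse_cons]
      simp only [h0, false_or]
      cases b <;> simp

theorem exists_start_iff (pre u : List CNFSym) (Q : List CNFSym → Prop) :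
    (∃ i < (pre ++ CNFSym.sep :: u).length, pre.length + 1 ≤ i ∧
      (pre ++ CNFSym.sep :: u)[i - 1]? = some CNFSym.sep ∧ Q ((pre ++ CNFSym.sep :: u).drop i)) ↔
    ∃ i < u.length, (i = 0 ∨ u[i - 1]? = some CNFSym.sep) ∧ Q (u.drop i) := by
  have hd : ∀ i, (pre ++ CNFSym.sep :: u).drop (pre.length + 1 + i) = u.drop i := by
    intro i
    rw [add_assoc, List.drop_append, List.drop_of_length_le (by omega), add_comm 1 i]
    simp
  have hg : ∀ i, (pre ++ CNFSym.sep :: u)[pre.length + 1 + i - 1]? = some CNFSym.sep ↔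
      (i = 0 ∨ u[i - 1]? = some CNFSym.sep) := by
    intro i
    rw [List.getElem?_append_right (by omega)]
    cases i with
    | zero => simp
    | succ i =>
      rw [show pre.length + 1 + (i + 1) - 1 - pre.length = i + 1 by omega]
      simp
  constructor
  · rintro ⟨i, hi, hp, h1, h2⟩
    obtain ⟨i, rfl⟩ := Nat.exists_eq_add_of_le hp
    rw [hd] at h2
    rw [hg] at h1
    simp only [List.length_append, List.length_cons] at hi
    exact ⟨i, by omega, h1, h2⟩
  · rintro ⟨i, hi, h1, h2⟩
    refine ⟨pre.length + 1 + i, ?_, by omega, (hg i).2 h1, ?_⟩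
    · simp only [List.length_append, List.length_cons]
      omega
    · rwa [hd]

/-- Separators occur only at the ends of clauses, so clauses start at 0 and right after separators;
`i < length` excludes the position after the last one. The formula thus never has to be decoded: a
quantifier over clauses is one over positions. -/
theorem exists_clause_start_iff {n : ℕ} {Q : List CNFSym → Prop} {R : Clause n → Prop} :
    ∀ {φ : CNF n}, (∀ cl ∈ φ, ∀ w, Q (encClause cl ++ w) ↔ R cl) →
      ((∃ i < (φ.flatMap encClause).length,
        (i = 0 ∨ (φ.flatMap encClause)[i - 1]? = some CNFSym.sep) ∧
          Q ((φ.flatMap encClause).drop i)) ↔ ∃ cl ∈ φ, R cl)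
  | [], _ => by simp
  | cl :: φ, hQ => by
      have ih := exists_clause_start_iff (φ := φ) fun c hc => hQ c (List.mem_cons_of_mem _ hc)
      have h0 := hQ cl List.mem_cons_self (φ.flatMap encClause)
      have hbody : ∀ i < (cl.flatMap encLiteral).length,
          (cl.flatMap encLiteral)[i]? ≠ some CNFSym.sep := by
        intro i _ h
        have h1 := List.mem_of_getElem? h
        simp only [List.mem_flatMap, encLiteral, List.mem_append, List.mem_replicate,
          List.mem_singleton] at h1
        obtain ⟨⟨v, b⟩, -, ⟨-, h⟩ | h⟩ := h1
        · cases h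
        · cases b <;> cases h
      have he : (cl :: φ).flatMap encClause =
          cl.flatMap encLiteral ++ CNFSym.sep :: φ.flatMap encClause := by
        simp [encClause]
      have he' : encClause cl ++ φ.flatMap encClause =
          cl.flatMap encLiteral ++ CNFSym.sep :: φ.flatMap encClause := by
        simp [encClause]
      rw [he'] at h0
      rw [he]
      simp only [List.exists_mem_cons_iff]
      refine Iff.trans ?_ (or_congr h0
        ((exists_start_iff (cl.flatMap encLiteral) (φ.flatMap encClause) Q).trans ih))
      constructor
      · rintro ⟨i, hi, h1, h2⟩
        rcases Nat.eq_zero_or_pos i with rfl | hpos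
        · exact .inl h2
        · have h3 := h1.resolve_left hpos.ne'
          refine .inr ⟨i, hi, ?_, h3, h2⟩
          by_contra hlt
          have h4 : i - 1 < (cl.flatMap encLiteral).length := by omega
          rw [List.getElem?_append_left h4] at h3
          exact hbody _ h4 h3
      · rintro (h | ⟨i, hi, -, h1, h2⟩)
        · exact ⟨0, by simp, .inl rfl, h⟩
        · exact ⟨i, hi, .inr h1, h2⟩

/-- A positive number is a power of two if 2 is its only prime divisor. The right-hand side needs
only remainders and a bounded quantifier. -/
theorem exists_eq_two_pow_iff {P : ℕ} :
    (∃ i, P = 2 ^ i) ↔ 0 < P ∧ ∀ q < P + 1, P % q = 0 → q = 1 ∨ q % 2 = 0 := by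
  constructor
  · rintro ⟨i, rfl⟩
    refine ⟨by positivity, fun q _ hq => ?_⟩
    obtain ⟨j, -, rfl⟩ := (Nat.dvd_prime_pow Nat.prime_two).1 (Nat.dvd_of_mod_eq_zero hq)
    cases j with
    | zero => exact .inl rfl
    | succ j => exact .inr (by simp [pow_succ])
  · rintro ⟨hP, h⟩
    refine ⟨_, Nat.eq_prime_pow_of_unique_prime_dvd hP.ne' fun {q} hq hqP => ?_⟩
    rcases h q (Nat.lt_succ_of_le (Nat.le_of_dvd hP hqP)) (Nat.mod_eq_zero_of_dvd hqP) with h1 | h1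
    · exact absurd h1 hq.one_lt.ne'
    · exact ((Nat.prime_dvd_prime_iff_eq Nat.prime_two hq).1 (Nat.dvd_of_mod_eq_zero h1)).symm

/-! ### Evaluation of formulas on the input tape. -/

section Comp

variable {B : Type} {α : Type} [Env CNFSym B α]

theorem comp_ones {f : α → ℕ} (hf : Comp f) : Comp fun a => ones ((Env.word a).drop (f a)) := by
  classical
  have h := (Comp.length (α := α)).card_filter_range
    (p := fun a i => ∀ j < i + 1, (Env.word a)[f a + j]? = some CNFSym.one)
    ((Comp.snd.add (Comp.const 1)).forall_lt
      (p := fun x j => (Env.word x.1)[f x.1 + j]? = some CNFSym.one)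
      ((hf.fst.fst.add Comp.snd).read CNFSym.one))
  refine Eq.subst (motive := Comp) (funext fun a => ?_) h
  have h1 := ones_le_length ((Env.word a).drop (f a))
  rw [List.length_drop] at h1
  have h2 : (Finset.range (Env.word a).length).filter
      (fun i => ∀ j < i + 1, (Env.word a)[f a + j]? = some CNFSym.one) =
        Finset.range (ones ((Env.word a).drop (f a))) := by
    ext i
    simp only [Finset.mem_filter, Finset.mem_range, lt_ones_iff, List.getElem?_drop]
    refine ⟨fun h => h.2, fun h => ⟨?_, h⟩⟩
    have h3 : i < ones ((Env.word a).drop (f a)) := by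
      rw [lt_ones_iff]
      simpa only [List.getElem?_drop] using h
    omega
  convert congrArg Finset.card h2
  simp

theorem compP_litFalse {l r v : α → ℕ} (hl : Comp l) (hr : Comp r) (hv : Comp v) :
    (b : Bool) → CompP fun a => LitFalse (l a) (r a) (v a) b
  | true => (hl.lt (hv.add (Comp.const 1))).and ((hv.add (Comp.const 1)).lt hr)
  | false => hl.eq (hv.add (Comp.const 1))

theorem compP_wordFalse {l r : ℕ → α → ℕ} (hl : ∀ p, Comp (l p)) (hr : ∀ p, Comp (r p)) :
    ∀ (m p : ℕ) {f : α → ℕ}, Comp f → CompP fun a =>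
      WordFalse (fun p => l p a) (fun p => r p a) m p ((Env.word a).drop (f a))
  | 0, p, f, hf => by
      refine (hf.read CNFSym.sep).congr fun a => ?_
      rw [WordFalse, List.getElem?_drop, add_zero]
  | m + 1, p, f, hf => by
      have ho := comp_ones hf
      have ih := compP_wordFalse hl hr m (p + 1) (hf.add (ho.add (Comp.const 1)))
      refine ((hf.read CNFSym.sep).or (CompP.and (CompP.or
        (((hf.add ho).read CNFSym.pos).and (compP_litFalse (hl p) (hr p) ho true))
        (((hf.add ho).read CNFSym.neg).and (compP_litFalse (hl p) (hr p) ho false))) ih)).congr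
          fun a => ?_
      rw [WordFalse, List.getElem?_drop, List.getElem?_drop, List.drop_drop, add_zero]

theorem comp_digit {M c : α → ℕ} (hM : Comp M) (hc : Comp c) (p : ℕ) :
    Comp fun a => digit (M a) p (c a) :=
  (hc.div (hM.pow p)).mod hM

theorem compP_two_pow {f : α → ℕ} (hf : Comp f) : CompP fun a => ∃ i, f a = 2 ^ i :=
  ((Comp.const 0).lt hf |>.and ((hf.add (Comp.const 1)).forall_lt
    (p := fun a q => f a % q = 0 → q = 1 ∨ q % 2 = 0)
    (((hf.fst.mod Comp.snd).eq (Comp.const 0)).imp ((Comp.snd.eq (Comp.const 1)).or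
      ((Comp.snd.mod (Comp.const 2)).eq (Comp.const 0)))))).congr
    fun _ => exists_eq_two_pow_iff.symm

variable {d : ℕ} {γ : α → WSatInst d}

theorem comp_n (hγ : ∀ a, Env.word a = (γ a).enc) : Comp fun a => (γ a).n := by
  refine Eq.subst (motive := Comp) (funext fun a => ?_) (comp_ones (Comp.const (α := α) 0))
  rw [hγ, List.drop_zero, WSatInst.enc, ones_replicate_append (by decide)]

theorem comp_k (hγ : ∀ a, Env.word a = (γ a).enc) : Comp fun a => (γ a).k := by
  refine Eq.subst (motive := Comp) (funext fun a => ?_)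
    (comp_ones ((comp_n hγ).add (Comp.const 1)))
  rw [hγ, WSatInst.enc, List.drop_append]
  simp [ones_replicate_append (s := CNFSym.sep) (by decide)]

theorem compP_exists_clauseFalse (hγ : ∀ a, Env.word a = (γ a).enc)
    {l r : ℕ → α → ℕ} (hl : ∀ p, Comp (l p)) (hr : ∀ p, Comp (r p)) : CompP fun a =>
      ∃ cl ∈ (γ a).formula, ClauseFalse (fun p => l p a) (fun p => r p a) 0 cl := by
  -- The number of variables and the weight, with their two separators, occupy `n + k + 2` symbols;
  -- clauses start from there on.
  refine ((Comp.length (α := α)).exists_lt (p := fun a i => (γ a).n + (γ a).k + 2 ≤ i ∧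
    (Env.word a)[i - 1]? = some CNFSym.sep ∧
      WordFalse (fun p => l p a) (fun p => r p a) d 0 ((Env.word a).drop i))
    ((((comp_n hγ).fst.add (comp_k hγ).fst).add (Comp.const 2)).le Comp.snd |>.and
      (((Comp.snd.sub (Comp.const 1)).read CNFSym.sep).and
        (compP_wordFalse (l := fun p x => l p x.1) (r := fun p x => r p x.1)
          (fun p => (hl p).fst) (fun p => (hr p).fst) d 0 Comp.snd)))).congr fun a => ?_
  have h1 := exists_start_iff (List.replicate (γ a).n CNFSym.one ++ CNFSym.sep ::
    List.replicate (γ a).k CNFSym.one) ((γ a).formula.flatMap encClause)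
      (WordFalse (fun p => l p a) (fun p => r p a) d 0)
  have h2 := exists_clause_start_iff (φ := (γ a).formula)
    (Q := WordFalse (fun p => l p a) (fun p => r p a) d 0)
    (R := ClauseFalse (fun p => l p a) (fun p => r p a) 0)
    fun cl hcl w => wordFalse_encClause_append _ _ w 0 cl ((γ a).width_le cl hcl)
  rw [← h2, ← h1, hγ, WSatInst.enc]
  simp only [List.length_append, List.length_replicate, List.length_cons, List.append_assoc,
    List.cons_append]
  rw [show (γ a).n + (γ a).k + 2 = (γ a).n + ((γ a).k + 1) + 1 by ring]

end Comp

end ParamComplexity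

/-! ## The reduction -/

namespace ParamComplexity

open RegisterProgram

namespace WSatInst

variable {d : ℕ} (x : WSatInst d)

/-- The weight asked for, unless it exceeds the number of variables by more than one. -/
def cap : ℕ := min x.k (x.n + 1)

/-- The number of tuples of `d + 1` gaps of a selection. -/
def blocks : ℕ := (x.cap + 1) ^ (d + 1)

/-- The number of candidates for the pairs of ends of `d + 1` gaps. -/
def candidates : ℕ := (x.n + 2) ^ (2 * (d + 1))

/-- The bits of a selection. -/
noncomputable def bits : Finset (ℕ × ℕ) := selBits x.n x.cap

/-- The vertex of the selection graph with a given number. -/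
def vertex (u : ℕ) : ℕ × ℕ × ℕ :=
  (u / (x.blocks * x.candidates), u / x.candidates % x.blocks, u % x.candidates)

/-- The selection graph of an instance. -/
noncomputable def selectionGraph : SimpleGraph (ℕ × ℕ × ℕ) :=
  selGraph x.blocks (GoodCandidate x.cap (d + 1) x.formula) x.bits (Conflict x.n x.cap (d + 1))

/-- The instance of Induced Matching for an instance of weighted satisfiability. -/
noncomputable def toInducedMatching : InducedMatchingInst where
  n := 5 * x.blocks * x.candidates
  graph := x.selectionGraph.comap fun u => x.vertex u
  size := x.blocks + x.bits.card

end WSatInst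

/-! ### Computability of the adjacency relation. -/

section Comp

variable {B : Type} {α : Type} [Env CNFSym B α] {d : ℕ} {γ : α → WSatInst d}

theorem comp_cap (hγ : ∀ a, Env.word a = (γ a).enc) : Comp fun a => (γ a).cap :=
  (comp_k hγ).min ((comp_n hγ).add (Comp.const 1))

theorem comp_blocks (hγ : ∀ a, Env.word a = (γ a).enc) : Comp fun a => (γ a).blocks :=
  ((comp_cap hγ).add (Comp.const 1)).pow (d + 1)

theorem comp_candidates (hγ : ∀ a, Env.word a = (γ a).enc) : Comp fun a => (γ a).candidates :=
  ((comp_n hγ).add (Comp.const 2)).pow (2 * (d + 1))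

theorem compP_goodCandidate (hγ : ∀ a, Env.word a = (γ a).enc) {j c : α → ℕ} (hj : Comp j)
    (hc : Comp c) :
    CompP fun a => GoodCandidate (γ a).cap (d + 1) (γ a).formula (j a) (c a) := by
  have hn := comp_n hγ
  have hk := comp_cap hγ
  have hM := hn.add (Comp.const 2)
  have hg := comp_digit (hk.add (Comp.const 1)) hj
  have hd := comp_digit hM hc
  have h1 := hc.lt (comp_candidates hγ)
  have h2 := CompP.forall_lt_const (n := d + 1)
    fun p _ => ((hd (2 * p)).lt (hd (2 * p + 1))).and
      ((((hg p).eq (Comp.const 0)).imp ((hd (2 * p)).eq (Comp.const 0))).and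
        (((hg p).eq hk).imp ((hd (2 * p + 1)).eq (hn.add (Comp.const 1)))))
  have h3 := compP_exists_clauseFalse hγ (fun p => hd (2 * p)) fun p => hd (2 * p + 1)
  refine (h1.and (h2.and h3.not)).congr fun a => ?_
  rw [GoodCandidate, WSatInst.candidates]
  simp only [not_exists, not_and]

theorem compP_conflict (hγ : ∀ a, Env.word a = (γ a).enc) {j c s P β : α → ℕ} (hj : Comp j)
    (hc : Comp c) (hs : Comp s) (hP : Comp P) (hβ : Comp β) :
    CompP fun a => Conflict (γ a).n (γ a).cap (d + 1) (j a) (c a) (s a) (P a) (β a) := by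
  have hg := comp_digit ((comp_cap hγ).add (Comp.const 1)) hj
  have hd := comp_digit ((comp_n hγ).add (Comp.const 2)) hc
  exact CompP.exists_lt_const (n := d + 1) fun p _ =>
    (((hg p).eq (hs.add (Comp.const 1))).and
      ((((hd (2 * p)).div hP).mod (Comp.const 2)).eq hβ).not).or
    (((hg p).eq hs).and ((((hd (2 * p + 1)).div hP).mod (Comp.const 2)).eq hβ).not)

theorem compP_mem_bits (hγ : ∀ a, Env.word a = (γ a).enc) {s P : α → ℕ} (hs : Comp s)
    (hP : Comp P) : CompP fun a => (s a, P a) ∈ (γ a).bits :=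
  ((hs.lt (comp_cap hγ)).and ((hP.lt ((comp_n hγ).add (Comp.const 2))).and
    (compP_two_pow hP))).congr fun a =>
      (mem_selBits (k := (γ a).cap) (b := (s a, P a))).symm

theorem comp_card_bits (hγ : ∀ a, Env.word a = (γ a).enc) : Comp fun a => (γ a).bits.card := by
  classical
  have h := (comp_cap hγ).mul (((comp_n hγ).add (Comp.const 2)).card_filter_range
    (p := fun _ P => ∃ i, P = 2 ^ i) (compP_two_pow Comp.snd))
  refine Eq.subst (motive := Comp) (funext fun a => ?_) h
  rw [WSatInst.bits, selBits, Finset.card_product, Finset.card_range]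

theorem compP_selArc (hγ : ∀ a, Env.word a = (γ a).enc) {u₁ u₂ u₃ v₁ v₂ v₃ : α → ℕ}
    (hu₁ : Comp u₁) (hu₂ : Comp u₂) (hu₃ : Comp u₃) (hv₁ : Comp v₁) (hv₂ : Comp v₂)
    (hv₃ : Comp v₃) :
    CompP fun a => SelArc (γ a).blocks (GoodCandidate (γ a).cap (d + 1) (γ a).formula)
      (γ a).bits (Conflict (γ a).n (γ a).cap (d + 1)) (u₁ a, u₂ a, u₃ a) (v₁ a, v₂ a, v₃ a) := by
  have hY := comp_blocks hγ
  have h1 := (hu₁.eq (Comp.const 0)).and ((hv₁.eq (Comp.const 1)).and ((hv₂.eq hu₂).and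
    ((hu₃.eq (Comp.const 0)).and ((hu₂.lt hY).and (compP_goodCandidate hγ hu₂ hv₃)))))
  have h2 := (hu₁.eq (Comp.const 1)).and ((hu₂.lt hY).and ((compP_goodCandidate hγ hu₂ hu₃).and
    ((compP_mem_bits hγ hv₂ hv₃).and (((hv₁.eq (Comp.const 2)).or (hv₁.eq (Comp.const 3))).and
      (compP_conflict hγ hu₂ hu₃ hv₂ hv₃ (hv₁.sub (Comp.const 2)))))))
  have h3 := ((Comp.const 2).le hu₁).and ((hu₁.lt hv₁).and ((hv₁.le (Comp.const 4)).and
    (((hv₂.eq hu₂).and (hv₃.eq hu₃)).and (compP_mem_bits hγ hu₂ hu₃))))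
  refine (h1.or (h2.or h3)).congr fun a => ?_
  rw [SelArc, Prod.mk.injEq]

theorem compP_selectionGraph_adj (hγ : ∀ a, Env.word a = (γ a).enc) {u v : α → ℕ} (hu : Comp u)
    (hv : Comp v) :
    CompP fun a => (γ a).selectionGraph.Adj ((γ a).vertex (u a)) ((γ a).vertex (v a)) := by
  have hY := comp_blocks hγ
  have hZ := comp_candidates hγ
  have h := fun {w : α → ℕ} (hw : Comp w) =>
    And.intro (hw.div (hY.mul hZ)) (And.intro ((hw.div hZ).mod hY) (hw.mod hZ))
  exact (compP_selArc hγ (h hu).1 (h hu).2.1 (h hu).2.2 (h hv).1 (h hv).2.1 (h hv).2.2).or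
    (compP_selArc hγ (h hv).1 (h hv).2.1 (h hv).2.2 (h hu).1 (h hu).2.1 (h hu).2.2)

end Comp

instance : Inhabited CNFSym := ⟨.one⟩

/-- An instance on the input tape, with no registers. -/
instance (d : ℕ) : Env CNFSym GraphSym (WSatInst d) where
  word := WSatInst.enc
  len := 0
  val _ _ := 0

-- Nested loops over numbers instead of `Fin n`, the form to which `Emits.flatMap_range` applies.
open Classical in
theorem encGraph_comap_eq {V : Type} (G : SimpleGraph V) (f : ℕ → V) (n : ℕ) :
    encGraph (G.comap fun u : Fin n => f u) = (List.range n).flatMap fun u =>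
      (List.range n).flatMap fun v =>
        [if G.Adj (f u) (f v) then GraphSym.one else GraphSym.zero] := by
  have h : List.range n = (List.finRange n).map Fin.val := by simp
  rw [h, List.flatMap_map, encGraph]
  simp only [List.flatMap_map, SimpleGraph.comap_adj]
  refine List.flatMap_congr fun u _ => ?_
  rw [← List.map_eq_flatMap]

theorem emits_enc_toInducedMatching (d : ℕ) :
    Emits fun x : WSatInst d => x.toInducedMatching.enc := by
  classical
  have hγ : ∀ x : WSatInst d, Env.word x = (id x).enc := fun _ => rfl
  have hN := ((Comp.const 5).mul (comp_blocks hγ)).mul (comp_candidates hγ)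
  have hadj := compP_selectionGraph_adj (α := (WSatInst d × ℕ) × ℕ) (γ := fun p => p.1.1)
    (fun _ => rfl) Comp.snd.fst Comp.snd
  have h1 := Emits.replicate hN GraphSym.one
  have h2 := Emits.replicate ((comp_blocks hγ).add (comp_card_bits hγ)) GraphSym.one
  have h3 := Emits.flatMap_range (f := fun x : WSatInst d => 5 * x.blocks * x.candidates)
    (g := fun x u => (List.range (5 * x.blocks * x.candidates)).flatMap fun v =>
      [if x.selectionGraph.Adj (x.vertex u) (x.vertex v) then GraphSym.one else GraphSym.zero]) hN
    (Emits.flatMap_range (f := fun p : WSatInst d × ℕ => 5 * p.1.blocks * p.1.candidates) hN.fst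
      (Emits.ite hadj GraphSym.one GraphSym.zero))
  have h := h1.append ((Emits.singleton GraphSym.sep).append
    (h2.append ((Emits.singleton GraphSym.sep).append h3)))
  convert h using 2 with x
  rw [InducedMatchingInst.enc, WSatInst.toInducedMatching]
  dsimp only
  rw [encGraph_comap_eq]
  rfl

end ParamComplexity

/-! ## Hardness -/

namespace ParamComplexity

open RegisterProgram

namespace WSatInst

variable {d : ℕ} (x : WSatInst d)

theorem blocks_pos : 0 < x.blocks := Nat.pow_pos (by omega)

theorem candidates_pos : 0 < x.candidates := Nat.pow_pos (by omega)

theorem vertex_injective : Function.Injective x.vertex := by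
  intro u v h
  simp only [vertex, Prod.mk.injEq, mul_comm x.blocks, ← Nat.div_div_eq_div_mul] at h
  obtain ⟨h1, h2, h3⟩ := h
  rw [← Nat.div_add_mod u x.candidates, ← Nat.div_add_mod v x.candidates, h3,
    ← Nat.div_add_mod (u / x.candidates) x.blocks, ← Nat.div_add_mod (v / x.candidates) x.blocks,
    h1, h2]

/-- Mixed-radix numbering of the box of triples with five kinds of vertices, `blocks` second and
`candidates` third coordinates. -/
theorem exists_vertex_eq {w : ℕ × ℕ × ℕ} (h1 : w.1 ≤ 4) (h2 : w.2.1 < x.blocks)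
    (h3 : w.2.2 < x.candidates) : ∃ u < 5 * x.blocks * x.candidates, x.vertex u = w := by
  have hd : (w.2.2 + x.candidates * (w.2.1 + x.blocks * w.1)) / x.candidates =
      w.2.1 + x.blocks * w.1 := by
    rw [Nat.add_mul_div_left _ _ x.candidates_pos, Nat.div_eq_of_lt h3, zero_add]
  refine ⟨w.2.2 + x.candidates * (w.2.1 + x.blocks * w.1), ?_, ?_⟩
  · calc w.2.2 + x.candidates * (w.2.1 + x.blocks * w.1)
        < x.candidates * (w.2.1 + x.blocks * w.1 + 1) := by
          rw [mul_add_one]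
          omega
      _ ≤ x.candidates * (5 * x.blocks) := by
          refine Nat.mul_le_mul_left _ ?_
          have := Nat.mul_le_mul_left x.blocks h1
          omega
      _ = 5 * x.blocks * x.candidates := mul_comm _ _
  · rw [vertex, mul_comm x.blocks x.candidates, ← Nat.div_div_eq_div_mul, hd,
      Nat.add_mul_div_left _ _ x.blocks_pos, Nat.div_eq_of_lt h2, zero_add, Nat.add_mul_mod_self_left,
      Nat.mod_eq_of_lt h2, Nat.add_mul_mod_self_left, Nat.mod_eq_of_lt h3]

/-- The triangle vertices use the block and candidate coordinates for the pair `(s, P)`, so bits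
have to fit into the same box. -/
theorem lt_of_mem_bits {b : ℕ × ℕ} (h : b ∈ x.bits) : b.1 < x.blocks ∧ b.2 < x.candidates := by
  obtain ⟨h1, h2, -⟩ := mem_selBits.1 h
  constructor
  · exact (h1.trans (Nat.lt_succ_self _)).trans_le (Nat.le_self_pow (by omega) _)
  · exact h2.trans_le (Nat.le_self_pow (by omega) _)

theorem selectionGraph_adj_bounds {u v : ℕ × ℕ × ℕ} (h : x.selectionGraph.Adj u v) :
    u.1 ≤ 4 ∧ u.2.1 < x.blocks ∧ u.2.2 < x.candidates := by
  have hc := x.candidates_pos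
  rcases h with (⟨h1, -, -, h2, h3, -⟩ | ⟨h1, h2, h3, -⟩ | ⟨-, h1, h2, -, h3⟩) |
    (⟨-, h1, h2, -, h3, h4⟩ | ⟨-, -, -, h1, h2, -⟩ | ⟨-, -, h1, h2, h3⟩)
  · exact ⟨by omega, h3, by omega⟩
  · exact ⟨by omega, h2, h3.1⟩
  · exact ⟨by omega, x.lt_of_mem_bits h3⟩
  · exact ⟨by omega, by omega, h4.1⟩
  · exact ⟨by omega, x.lt_of_mem_bits h1⟩
  · exact ⟨h1, x.lt_of_mem_bits (h2 ▸ h3)⟩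

theorem hasInducedMatching_toInducedMatching_iff :
    HasInducedMatching x.toInducedMatching.graph x.toInducedMatching.size ↔
      HasInducedMatching x.selectionGraph (x.blocks + x.bits.card) := by
  refine hasInducedMatching_comap (φ := fun u : Fin (5 * x.blocks * x.candidates) => x.vertex u)
    (fun u v h => Fin.ext (x.vertex_injective h)) (fun u v h => ?_) _
  obtain ⟨h1, h2, h3⟩ := x.selectionGraph_adj_bounds h
  obtain ⟨u', hu, rfl⟩ := x.exists_vertex_eq h1 h2 h3
  exact ⟨⟨u', hu⟩, rfl⟩

theorem mem_yes_iff :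
    (∃ a : Fin x.n → Bool, x.formula.Sat a ∧ weight a = x.k) ↔
      HasInducedMatching x.toInducedMatching.graph x.toInducedMatching.size := by
  -- Width `d + 1` instead of `d` guarantees at least one gap per tuple, also for `d = 0`.
  have hw : ∀ c ∈ x.formula, c.length ≤ d + 1 := fun c hc => (x.width_le c hc).trans (by omega)
  rw [hasInducedMatching_toInducedMatching_iff]
  constructor
  · rintro ⟨a, ha, hk⟩
    obtain ⟨y, hy, he⟩ := exists_isSelection a
    rw [hk] at hy he
    have hcap : x.cap = x.k := min_eq_left (hy.le.trans (Nat.le_succ _))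
    rw [← hcap] at hy he
    rw [he] at ha
    obtain ⟨b, hb, c, hc⟩ := exists_assignment_of_isSelection hw hy ha
    exact hasInducedMatching_selGraph_of_assignment b hb c hc
  · intro h
    obtain ⟨b, -, hc⟩ := exists_assignment_of_hasInducedMatching_selGraph h
    obtain ⟨y, hy, hs⟩ := exists_isSelection_of_assignment (Nat.succ_pos d) hw hc
    -- A selection of size `cap` exists only if `cap ≤ n`; this excludes `cap = n + 1` and leaves
    -- `cap = k`.
    have hle := hy.le
    refine ⟨_, hs, hy.weight.trans ?_⟩
    rw [cap] at hle ⊢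
    omega

/-- The reason for `cap`: with at most one variable the parameter is 0 although `k` may be
arbitrarily large, but then `cap ≤ 2`. With two or more variables the logarithm is positive and `k`
itself is bounded by the parameter. -/
theorem cap_le : x.cap ≤ x.k * Nat.clog 2 x.n + 2 := by
  rcases Nat.lt_or_ge x.n 2 with h | h
  · exact (min_le_right _ _).trans (by omega)
  · exact (min_le_left _ _).trans
      ((Nat.le_mul_of_pos_right _ (Nat.clog_pos one_lt_two h)).trans (Nat.le_add_right _ _))

theorem card_bits_le : x.bits.card ≤ x.k * Nat.clog 2 x.n + 2 * (x.k * Nat.clog 2 x.n + 2) := by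
  classical
  have h1 : ((Finset.range (x.n + 2)).filter fun P => ∃ i, P = 2 ^ i).card ≤
      Nat.clog 2 x.n + 2 := by
    rw [← Finset.card_range (Nat.clog 2 x.n + 2)]
    refine (Finset.card_le_card fun P hP => ?_).trans
      (Finset.card_image_le (s := Finset.range (Nat.clog 2 x.n + 2)) (f := fun i => 2 ^ i))
    obtain ⟨hP, i, rfl⟩ := Finset.mem_filter.1 hP
    rw [Finset.mem_range] at hP
    refine Finset.mem_image_of_mem _ (Finset.mem_range.2 ?_)
    -- An exponent from `clog 2 n + 2` on gives a power of at least `4 * 2 ^ clog 2 n`, which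
    -- exceeds `n + 2`.
    by_contra! hi
    have h2 := Nat.pow_le_pow_right (n := 2) (by omega) hi
    have h3 := Nat.le_pow_clog one_lt_two x.n
    have h4 := Nat.two_pow_pos (Nat.clog 2 x.n)
    rw [pow_add] at h2
    omega
  have h2 : x.bits.card ≤ x.cap * (Nat.clog 2 x.n + 2) := by
    rw [bits, selBits, Finset.card_product, Finset.card_range]
    refine Nat.mul_le_mul_left _ ?_
    convert h1
  have h3 : x.cap * Nat.clog 2 x.n ≤ x.k * Nat.clog 2 x.n :=
    Nat.mul_le_mul_right _ (min_le_left _ _)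
  have h4 := x.cap_le
  rw [mul_add] at h2
  omega

theorem vertexCoverNum_toInducedMatching_le :
    x.toInducedMatching.graph.vertexCoverNum.toNat ≤ (x.k * Nat.clog 2 x.n + 3) ^ (d + 1) +
      3 * (x.k * Nat.clog 2 x.n + 2 * (x.k * Nat.clog 2 x.n + 2)) := by
  refine (vertexCoverNum_comap_selGraph_le
    (φ := fun u : Fin (5 * x.blocks * x.candidates) => x.vertex u)
    fun u v h => Fin.ext (x.vertex_injective h)).trans (add_le_add ?_ ?_)
  · exact Nat.pow_le_pow_left (Nat.succ_le_succ x.cap_le) _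
  · exact Nat.mul_le_mul_left _ x.card_bits_le

end WSatInst

theorem PPT.trans {P Q R : ParamProblem} : PPT P Q → PPT Q R → PPT P R := by
  rintro ⟨f, ⟨hf⟩, hf', p, hp⟩ ⟨g, ⟨hg⟩, hg', q, hq⟩
  refine ⟨g ∘ f, hf.nonempty_comp hg, fun x => (hf' x).trans (hg' (f x)), q.comp p, fun x => ?_⟩
  rw [Polynomial.eval_comp]
  exact (hq (f x)).trans (q.eval_mono_nat (hp x))

theorem ppt_wsat_inducedMatchingVC (d : ℕ) : PPT (wsat d) inducedMatchingVC := by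
  refine ⟨WSatInst.toInducedMatching,
    (emits_enc_toInducedMatching d).nonempty_polyTime rfl, fun x => x.mem_yes_iff,
    (Polynomial.X + 3) ^ (d + 1) + 3 * (Polynomial.X + 2 * (Polynomial.X + 2)), fun x => ?_⟩
  simpa [wsat, inducedMatchingVC] using x.vertexCoverNum_toInducedMatching_le

end ParamComplexity

/-- Induced Matching parameterized by the vertex cover number is `WK[1]`-hard. -/
theorem mainTheorem4 :
    ParamComplexity.IsHardFor ParamComplexity.WK1 ParamComplexity.inducedMatchingVC :=
  fun _ ⟨d, hd⟩ => hd.trans (ParamComplexity.ppt_wsat_inducedMatchingVC d)
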